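/- **Setting.** There are $U\ge 1$ users, $K\ge 1$ arms with costs $c_k\in\mathbb N$, a budget $B\in\mathbb N$ with $c_k\le B$ for all $k$, and a horizon $T\ge \max\{U,K\}$. A matching is a map $\pi:[U]\to[K]$; it is feasible ($\pi\in\Pi$) if $\sum_{k\in \mathrm{Im}(\pi)}c_k\le B$. The rewards $r^t_{u,k}$ ($t\in[T]$, $u\in[U]$, $k\in[K]$) are independent, $r^t_{u,k}\sim D_{u,k}$ with $D_{u,k}$ supported on $[0,1]$ and with mean $\theta_{u,k}$; $\Theta=(\theta_{u,k})$. Put $V(\pi;P)=\sum_u P_{u,\pi(u)}$. In each round $t$ a learner chooses a matching $\pi_t$ from the history $H_t$ and then observes $r^t_{u,\pi_t(u)}$ for every $u$. Its regret is $R_T=T\max_{\pi\in\Pi}V(\pi;\Theta)-\mathbb E\big[\sum_{t=1}^T\sum_u r^t_{u,\pi_t(u)}\big]$. A matrix is single-peaked (SP) w.r.t. a total order $\prec$ on the arms with peaks $p(\cdot)$ if each row $u$ is nondecreasing along $\prec$ up to the arm $p(u)$ and nonincreasing from there on. Assume that $\Theta$ is SP w.r.t. $\prec$ with peaks $p(\cdot)$,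 and that $\prec$, $p$, $c$, $B$, $T$ are known to the learner. **Confidence set and maximal matrix.** Let $n_{u,k}(t)$ and $\bar\theta_{u,k}(t)$ be the number of pulls and the empirical mean (0 if there was no pull) of $(u,k)$ before round $t$, and let $UCB_{u,k}(t),LCB_{u,k}(t)=\bar\theta_{u,k}(t)\pm\sqrt{2\ln T/\max\{1,n_{u,k}(t)\}}$. The confidence set $\mathcal C^t$ consists of all matrices $P$ that are SP w.r.t. $\prec$ with peaks $p(\cdot)$ and satisfy $LCB_{u,k}(t)\le P_{u,k}\le UCB_{u,k}(t)$ for all $u,k$. The maximal matrix is $P^t_{u,k}=\min_i UCB_{u,i}(t)$, the minimum being over all arms $i$ between $k$ and $p(u)$ (inclusive) in the order $\prec$; it is the elementwise greatest element of $\mathcal C^t$ whenever $\mathcal C^t\neq\emptyset$. **SP-Matching$(P)$.** Number the arms $1,\dots,K$ along $\prec$, and add an auxiliary arm $0$ with $c_0=0$ and $P_{u,0}=0$. Let $G_{i,j}=\sum_{u:\,i<p(u)\le j}\max\{P_{u,i},P_{u,j}\}$, $F(0,b)=0$ for $0\le b\le B$, and for $k=1,\dots,K$ and $c_k\le b\le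 B$ $$F(k,b)=\max_{0\le i<k,\ c_i+c_k\le b}\big[F(i,b-c_k)+G_{i,k}\big].$$ Choose $k\in[K]$ maximizing $F(k,B)+\sum_{u:\,p(u)>k}P_{u,k}$, backtrack from $(k,B)$ through the maximizing $i$'s until arm $0$ is reached to get the set $S^\star\subseteq[K]$ of selected arms, and return $\pi(u)=\arg\max_{k\in S^\star}P_{u,k}$. Ties are broken towards the smaller number. **MvM** plays $\pi_t=\text{SP-Matching}(P^t)$ in every round $t$. **Theorem.** For every such instance, every matching played by MvM is feasible, the regret of MvM satisfies $$R_T = O\big(U\sqrt{TK\ln T}\big),$$ and MvM has per-round runtime $O(K^2U+K^2B)$. The constants are absolute. The runtime is on a unit-cost random access machine with natural and real memory cells (with $+,-,\times,\div,\sqrt{\cdot},\ln$ on reals, $+$ and truncated $-$ on naturals, comparisons, memory accesses and counted loops; two-dimensional arrays). That is, there are two fixed programs, independent of the instance, such that on a machine whose memory initially holds only $U,K,B,T,c,\prec,p$ and persists between rounds, for every sequence of rewards and in every round, the first program outputs $\pi_t$, the second one then processes the observed rewards, and the two together take $O(K^2U+K^2B)$ steps. -/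

import Mathlib

open MeasureTheory

namespace CBR

/-! ### The model -/

/-- A matching assigns one arm to every user. -/
abbrev Matching (U K : ℕ) := Fin U → Fin K

/-- A constrained bandit recommendation instance with `U` users and `K` arms: horizon `T`,
reward distributions `D u k` on `[0, 1]`, arm costs `c` and budget `B`. -/
structure Instance (U K : ℕ) where
  T : ℕ
  D : Fin U → Fin K → Measure ℝ
  isProb : ∀ u k, IsProbabilityMeasure (D u k)
  supported : ∀ u k, D u k (Set.Icc 0 1) = 1
  c : Fin K → ℕ
  B : ℕ
  cost_le : ∀ k, c k ≤ B
  arms_le : K ≤ T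
  users_le : U ≤ T

attribute [instance] Instance.isProb

variable {U K : ℕ}

/-- The expected reward matrix. -/
noncomputable def Instance.Θ (I : Instance U K) (u : Fin U) (k : Fin K) : ℝ :=
  ∫ x, x ∂(I.D u k)

/-- The value `V(π; M)` of a matching with respect to a reward matrix. -/
noncomputable def value (M : Fin U → Fin K → ℝ) (π : Matching U K) : ℝ :=
  ∑ u, M u (π u)

/-- The total cost of the arms in the image of `π` is within the budget. -/
def Feasible (c : Fin K → ℕ) (B : ℕ) (π : Matching U K) : Prop :=
  ∑ k ∈ Finset.univ.image π, c k ≤ B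

/-- The optimal value over feasible matchings; the set is finite, and it is nonempty as soon as
`0 < K`, since every single arm is affordable. -/
noncomputable def Instance.opt (I : Instance U K) : ℝ :=
  sSup (value I.Θ '' {π | Feasible I.c I.B π})

/-- What is observed in a round: the matching played and one reward for each user. -/
abbrev Obs (U K : ℕ) := Matching U K × (Fin U → ℝ)

/-- A (deterministic) learner maps the history, oldest observation first, to a matching. -/
abbrev Policy (U K : ℕ) := List (Obs U K) → Matching U K

/-- A table of rewards: the entry `(t, u, k)` is the reward that user `u` would generate in
round `t` (counted from `0`) if matched to arm `k`. -/
abbrev Rewards (U K : ℕ) := ℕ × Fin U × Fin K → ℝ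

/-- The history before round `t`: only the rewards of the matched pairs are observed. -/
def history (A : Policy U K) (r : Rewards U K) : ℕ → List (Obs U K)
  | 0 => []
  | t + 1 => history A r t ++
      [(A (history A r t), fun u => r (t, u, A (history A r t) u))]

/-- The matching played in round `t`. -/
def play (A : Policy U K) (r : Rewards U K) (t : ℕ) : Matching U K :=
  A (history A r t)

/-- All rewards are independent, the one of the pair `(u, k)` having law `D u k` in every round. -/
noncomputable def Instance.rewardLaw (I : Instance U K) : Measure (Rewards U K) :=
  Measure.infinitePi fun x : ℕ × Fin U × Fin K => I.D x.2.1 x.2.2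

/-- The expected cumulative regret over the `T` rounds. -/
noncomputable def Instance.regret (I : Instance U K) (A : Policy U K) : ℝ :=
  I.T * I.opt -
    ∫ r, ∑ t ∈ Finset.range I.T, ∑ u, r (t, u, play A r t u) ∂I.rewardLaw

/-! ### Single-peaked matrices -/

/-- Every row of `M` is nondecreasing up to the index `q u` and nonincreasing from there on. -/
def PSPWithPeaks (M : Fin U → Fin K → ℝ) (q : Fin U → Fin K) : Prop :=
  ∀ u, MonotoneOn (M u) (Set.Iic (q u)) ∧ AntitoneOn (M u) (Set.Ici (q u))

/-- `M` is single-peaked with respect to the order `σ 0 ≺ σ 1 ≺ ⋯` on the arms, and the arm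
`p u` is a peak of user `u`. -/
def SPWithPeaks (σ : Equiv.Perm (Fin K)) (p : Fin U → Fin K) (M : Fin U → Fin K → ℝ) : Prop :=
  PSPWithPeaks (fun u j => M u (σ j)) (fun u => σ.symm (p u))

/-! ### Confidence bounds, confidence set and maximal matrix -/

/-- The number of past pulls of the pair `(u, k)`. -/
def pulls (h : List (Obs U K)) (u : Fin U) (k : Fin K) : ℕ :=
  h.countP fun o => o.1 u = k

/-- The empirical mean of the pair `(u, k)`, equal to `0` if it was never pulled. -/
noncomputable def empMean (h : List (Obs U K)) (u : Fin U) (k : Fin K) : ℝ :=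
  (h.map fun o => if o.1 u = k then o.2 u else 0).sum / pulls h u k

/-- The confidence radius; a pair that was never pulled is treated as if pulled once. -/
noncomputable def radius (T : ℕ) (h : List (Obs U K)) (u : Fin U) (k : Fin K) : ℝ :=
  √(2 * Real.log T / (max 1 (pulls h u k) : ℕ))

noncomputable def ucb (T : ℕ) (h : List (Obs U K)) (u : Fin U) (k : Fin K) : ℝ :=
  empMean h u k + radius T h u k

noncomputable def lcb (T : ℕ) (h : List (Obs U K)) (u : Fin U) (k : Fin K) : ℝ :=
  empMean h u k - radius T h u k

/-- The matrices that are consistent with the order, the peaks and the confidence bounds. -/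
def confidenceSet (T : ℕ) (σ : Equiv.Perm (Fin K)) (p : Fin U → Fin K)
    (h : List (Obs U K)) : Set (Fin U → Fin K → ℝ) :=
  {P | SPWithPeaks σ p P ∧ ∀ u k, lcb T h u k ≤ P u k ∧ P u k ≤ ucb T h u k}

/-- The least upper confidence bound among the arms that lie, in the order `σ`, between `k` and
the peak of `u`, both included. -/
noncomputable def maximalMatrix (T : ℕ) (σ : Equiv.Perm (Fin K)) (p : Fin U → Fin K)
    (h : List (Obs U K)) (u : Fin U) (k : Fin K) : ℝ :=
  (Finset.uIcc (σ.symm k) (σ.symm (p u))).inf' Finset.nonempty_uIcc fun j => ucb T h u (σ j)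

/-- Whenever the confidence set is nonempty, `maximalMatrix` is its greatest element. -/
theorem isGreatest_maximalMatrix (T : ℕ) (σ : Equiv.Perm (Fin K)) (p : Fin U → Fin K)
    (h : List (Obs U K)) (hne : (confidenceSet T σ p h).Nonempty) :
    IsGreatest (confidenceSet T σ p h) (maximalMatrix T σ p h) := by
  have upper : maximalMatrix T σ p h ∈ upperBounds (confidenceSet T σ p h) := by
    intro P hP u k
    refine Finset.le_inf' _ _ fun j hj => ?_
    refine le_trans ?_ (hP.2 u (σ j)).2
    have hu := hP.1 u
    rcases le_total (σ.symm k) (σ.symm (p u)) with hk | hk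
    · rw [Finset.uIcc_of_le hk, Finset.mem_Icc] at hj
      simpa using hu.1 (Set.mem_Iic.2 hk) (Set.mem_Iic.2 hj.2) hj.1
    · rw [Finset.uIcc_of_ge hk, Finset.mem_Icc] at hj
      simpa using hu.2 (Set.mem_Ici.2 hj.1) (Set.mem_Ici.2 hk) hj.2
  refine ⟨⟨fun u => ⟨fun i hi j hj hij => ?_, fun i hi j hj hij => ?_⟩, fun u k => ⟨?_, ?_⟩⟩,
    upper⟩
  · simp only [maximalMatrix, Equiv.symm_apply_apply]
    refine Finset.inf'_mono _ ?_ _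
    rw [Finset.uIcc_of_le (Set.mem_Iic.1 hi), Finset.uIcc_of_le (Set.mem_Iic.1 hj)]
    exact Finset.Icc_subset_Icc_left hij
  · simp only [maximalMatrix, Equiv.symm_apply_apply]
    refine Finset.inf'_mono _ ?_ _
    rw [Finset.uIcc_of_ge (Set.mem_Ici.1 hi), Finset.uIcc_of_ge (Set.mem_Ici.1 hj)]
    exact Finset.Icc_subset_Icc_right hij
  · obtain ⟨P, hP⟩ := hne
    exact le_trans (hP.2 u k).1 (upper hP u k)
  · refine (Finset.inf'_le _ (Finset.left_mem_uIcc)).trans ?_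
    simp

/-! ### SP-Matching

Arms are numbered `1, …, K` in the given order, and `0` is the auxiliary arm, of cost `0` and
reward `0`. The peak of user `u` is therefore the number `q u + 1`. All ties are broken in favour
of the smallest number. -/

/-- Extends a function on the arms by `0` at the auxiliary arm. -/
def pad {α : Type} [Zero α] (f : Fin K → α) : ℕ → α
  | 0 => 0
  | j + 1 => if h : j < K then f ⟨j, h⟩ else 0

/-- The smallest maximizer of `f` on `s`. -/
noncomputable def argmax (s : Finset ℕ) (f : ℕ → ℝ) : ℕ :=
  sInf {i | i ∈ s ∧ ∀ j ∈ s, f j ≤ f i}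

/-- `G i j`, the sum over the users with peak in `(i, j]` of their better reward among `i`, `j`. -/
noncomputable def spG (P : Fin U → Fin K → ℝ) (q : Fin U → Fin K) (i j : ℕ) : ℝ :=
  ∑ u with i < (q u : ℕ) + 1 ∧ (q u : ℕ) + 1 ≤ j, max (pad (P u) i) (pad (P u) j)

/-- The candidates for the second rightmost arm if `k` is the rightmost one and the budget is
`b`. -/
def spCandidates (c : Fin K → ℕ) (k b : ℕ) : Finset ℕ :=
  {i ∈ Finset.range k | pad c i + pad c k ≤ b}

/-- The dynamic programming table after the rows `0, …, n` have been filled. Row `k` is used only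
at budgets `b ≥ c k`, where its set of candidates is nonempty. -/
noncomputable def spTable (P : Fin U → Fin K → ℝ) (q : Fin U → Fin K) (c : Fin K → ℕ) :
    ℕ → ℕ → ℕ → ℝ
  | 0 => fun _ _ => 0
  | n + 1 => Function.update (spTable P q c n) (n + 1) fun b =>
      let f := fun i => spTable P q c n i (b - pad c (n + 1)) + spG P q i (n + 1)
      f (argmax (spCandidates c (n + 1) b) f)

/-- The table `F k b`. -/
noncomputable def spF (P : Fin U → Fin K → ℝ) (q : Fin U → Fin K) (c : Fin K → ℕ)
    (k b : ℕ) : ℝ :=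
  spTable P q c K k b

/-- The arm at which the maximum that defines `F k b` is attained. -/
noncomputable def spPrev (P : Fin U → Fin K → ℝ) (q : Fin U → Fin K) (c : Fin K → ℕ)
    (k b : ℕ) : ℕ :=
  argmax (spCandidates c k b) fun i => spF P q c i (b - pad c k) + spG P q i k

/-- The rightmost selected arm, at which `V⋆` is attained. -/
noncomputable def spLast (P : Fin U → Fin K → ℝ) (q : Fin U → Fin K) (c : Fin K → ℕ)
    (B : ℕ) : ℕ :=
  argmax (Finset.Icc 1 K) fun k =>
    spF P q c k B + ∑ u with k < (q u : ℕ) + 1, pad (P u) k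

/-- Backtracking from the table entry `(k, b)`, in at most `n` steps. -/
noncomputable def spBacktrack (P : Fin U → Fin K → ℝ) (q : Fin U → Fin K) (c : Fin K → ℕ) :
    ℕ → ℕ → ℕ → Finset ℕ
  | 0, _, _ => ∅
  | n + 1, k, b =>
      if k = 0 then ∅
      else insert k (spBacktrack P q c n (spPrev P q c k b) (b - pad c k))

/-- The set of selected arms. -/
noncomputable def spSelected (P : Fin U → Fin K → ℝ) (q : Fin U → Fin K) (c : Fin K → ℕ)
    (B : ℕ) : Finset ℕ :=
  spBacktrack P q c K (spLast P q c B) B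

/-- The matching returned: every user gets their best selected arm. (The selected set is a
nonempty subset of `{1, …, K}` if every cost is at most `B`, so the `else` branch is never
reached.) -/
noncomputable def spMatching (P : Fin U → Fin K → ℝ) (q : Fin U → Fin K) (c : Fin K → ℕ)
    (B : ℕ) : Matching U K := fun u =>
  let k := argmax (spSelected P q c B) (pad (P u))
  if h : k - 1 < K then ⟨k - 1, h⟩ else q u

/-! ### Match-via-Maximal -/

/-- The learner that knows `T`, `B`, the costs, the order and the peaks, and plays SP-Matching on
the maximal matrix, with columns (and costs and peaks) rearranged according to the order. -/
noncomputable def mvm (T B : ℕ) (c : Fin K → ℕ) (σ : Equiv.Perm (Fin K)) (p : Fin U → Fin K) :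
    Policy U K := fun h u =>
  σ (spMatching (fun v j => maximalMatrix T σ p h v (σ j)) (fun v => σ.symm (p v))
    (fun j => c (σ j)) B u)

/-! ### A unit-cost random access machine over the natural and the real numbers

The memory consists of two-dimensional arrays, numbered `0, 1, 2, …`, of natural and of real
cells. Every arithmetic operation, comparison, constant and memory access costs one step. -/

structure Memory where
  nat : ℕ → ℕ → ℕ → ℕ
  real : ℕ → ℕ → ℕ → ℝ

def Memory.setNat (m : Memory) (a i j v : ℕ) : Memory :=
  { m with nat := fun a' i' j' => if a' = a ∧ i' = i ∧ j' = j then v else m.nat a' i' j' }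

noncomputable def Memory.setReal (m : Memory) (a i j : ℕ) (v : ℝ) : Memory :=
  { m with real := fun a' i' j' => if a' = a ∧ i' = i ∧ j' = j then v else m.real a' i' j' }

/-- Expressions with natural values. -/
inductive NExp where
  | lit (n : ℕ)
  | get (a : ℕ) (i j : NExp)
  | add (e f : NExp)
  | sub (e f : NExp)

def NExp.eval (m : Memory) : NExp → ℕ
  | lit n => n
  | get a i j => m.nat a (i.eval m) (j.eval m)
  | add e f => e.eval m + f.eval m
  | sub e f => e.eval m - f.eval m

def NExp.cost : NExp → ℕ
  | lit _ => 1
  | get _ i j => i.cost + j.cost + 1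
  | add e f => e.cost + f.cost + 1
  | sub e f => e.cost + f.cost + 1

/-- Expressions with real values. -/
inductive RExp where
  | ofNat (e : NExp)
  | get (a : ℕ) (i j : NExp)
  | add (e f : RExp)
  | sub (e f : RExp)
  | mul (e f : RExp)
  | div (e f : RExp)
  | sqrt (e : RExp)
  | log (e : RExp)

noncomputable def RExp.eval (m : Memory) : RExp → ℝ
  | ofNat e => (e.eval m : ℝ)
  | get a i j => m.real a (i.eval m) (j.eval m)
  | add e f => e.eval m + f.eval m
  | sub e f => e.eval m - f.eval m
  | mul e f => e.eval m * f.eval m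
  | div e f => e.eval m / f.eval m
  | sqrt e => √(e.eval m)
  | log e => Real.log (e.eval m)

def RExp.cost : RExp → ℕ
  | ofNat e => e.cost + 1
  | get _ i j => i.cost + j.cost + 1
  | add e f => e.cost + f.cost + 1
  | sub e f => e.cost + f.cost + 1
  | mul e f => e.cost + f.cost + 1
  | div e f => e.cost + f.cost + 1
  | sqrt e => e.cost + 1
  | log e => e.cost + 1

/-- Tests. -/
inductive Test where
  | natLe (e f : NExp)
  | realLe (e f : RExp)

def Test.holds (m : Memory) : Test → Prop
  | natLe e f => e.eval m ≤ f.eval m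
  | realLe e f => e.eval m ≤ f.eval m

def Test.cost : Test → ℕ
  | natLe e f => e.cost + f.cost + 1
  | realLe e f => e.cost + f.cost + 1

/-- Programs. `loop x e body` evaluates `e` once, to a number `n`, and runs `body` for the values
`0, …, n - 1` of the counter, which is stored in the natural cell `(x, 0, 0)`. -/
inductive Program where
  | skip
  | setNat (a : ℕ) (i j : NExp) (e : NExp)
  | setReal (a : ℕ) (i j : NExp) (e : RExp)
  | seq (P Q : Program)
  | ite (b : Test) (P Q : Program)
  | loop (x : ℕ) (e : NExp) (body : Program)

open Classical in
/-- Runs a program; returns the final memory and the number of steps taken. -/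
noncomputable def Program.run : Program → Memory → Memory × ℕ
  | skip, m => (m, 1)
  | setNat a i j e, m =>
      (m.setNat a (i.eval m) (j.eval m) (e.eval m), i.cost + j.cost + e.cost + 1)
  | setReal a i j e, m =>
      (m.setReal a (i.eval m) (j.eval m) (e.eval m), i.cost + j.cost + e.cost + 1)
  | seq P Q, m =>
      ((Q.run (P.run m).1).1, (P.run m).2 + (Q.run (P.run m).1).2)
  | ite b P Q, m =>
      if b.holds m then ((P.run m).1, b.cost + (P.run m).2 + 1)
      else ((Q.run m).1, b.cost + (Q.run m).2 + 1)
  | loop x e body, m =>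
      (List.range (e.eval m)).foldl
        (fun s i =>
          ((body.run (s.1.setNat x 0 0 i)).1, s.2 + (body.run (s.1.setNat x 0 0 i)).2 + 1))
        (m, e.cost + 1)

/-- The memory before the first round. It holds `U`, `K`, `B`, `T` in the natural array `0`, the
costs in array `1`, the arms listed in their order in array `2` and the peaks in array `3`. All
other cells are `0`. -/
def initialMemory (T B : ℕ) (c : Fin K → ℕ) (σ : Equiv.Perm (Fin K)) (p : Fin U → Fin K) :
    Memory where
  nat := fun a i j =>
    if j = 0 then
      match a with
      | 0 => match i with
        | 0 => U
        | 1 => K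
        | 2 => B
        | 3 => T
        | _ => 0
      | 1 => if h : i < K then c ⟨i, h⟩ else 0
      | 2 => if h : i < K then (σ ⟨i, h⟩ : ℕ) else 0
      | 3 => if h : i < U then (p ⟨i, h⟩ : ℕ) else 0
      | _ => 0
    else 0
  real := fun _ _ _ => 0

/-- The matching `π` is written in the natural array `4`. -/
def Memory.Outputs (m : Memory) (π : Matching U K) : Prop :=
  ∀ u : Fin U, m.nat 4 u 0 = (π u : ℕ)

/-- The observed reward of user `u` is placed in the cell `(0, u, 0)` of the real memory. -/
noncomputable def Memory.receive (m : Memory) (x : Fin U → ℝ) : Memory :=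
  { m with real := fun a i j =>
      if h : a = 0 ∧ i < U ∧ j = 0 then x ⟨i, h.2.1⟩ else m.real a i j }

/-- The memory at the beginning of round `t` of a machine that, in every round, runs `choose` to
select the matching, then receives the rewards `x t` and runs `learn`. Memory persists from one
round to the next. -/
noncomputable def memoryAt (choose learn : Program) (m₀ : Memory) (x : ℕ → Fin U → ℝ) :
    ℕ → Memory
  | 0 => m₀
  | t + 1 => (learn.run ((choose.run (memoryAt choose learn m₀ x t)).1.receive (x t))).1

/-- The number of steps that the machine takes in round `t`. -/
noncomputable def roundSteps (choose learn : Program) (m₀ : Memory) (x : ℕ → Fin U → ℝ)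
    (t : ℕ) : ℕ :=
  (choose.run (memoryAt choose learn m₀ x t)).2 +
    (learn.run ((choose.run (memoryAt choose learn m₀ x t)).1.receive (x t))).2

end CBR

namespace CBR

variable {U K : ℕ}

/-! ### Correctness of SP-Matching -/

theorem argmax_mem {s : Finset ℕ} (hs : s.Nonempty) (f : ℕ → ℝ) : argmax s f ∈ s :=
  (Nat.sInf_mem (s := {i | i ∈ s ∧ ∀ j ∈ s, f j ≤ f i}) (s.exists_max_image f hs)).1

theorem le_argmax {s : Finset ℕ} (f : ℕ → ℝ) {j : ℕ} (hj : j ∈ s) : f j ≤ f (argmax s f) :=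
  (Nat.sInf_mem (s := {i | i ∈ s ∧ ∀ j ∈ s, f j ≤ f i}) (s.exists_max_image f ⟨j, hj⟩)).2 j hj

@[simp] theorem argmax_empty (f : ℕ → ℝ) : argmax ∅ f = 0 := by
  simp [argmax]

theorem argmax_eq_iff {s : Finset ℕ} (hs : s.Nonempty) (f : ℕ → ℝ) (i : ℕ) :
    argmax s f = i ↔ i ∈ s ∧ (∀ j ∈ s, f j ≤ f i) ∧ ∀ j ∈ s, j < i → f j < f i := by
  constructor
  · rintro rfl
    refine ⟨argmax_mem hs f, fun j hj => le_argmax f hj, fun j hj hlt => ?_⟩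
    by_contra! hle
    exact Nat.notMem_of_lt_sInf hlt ⟨hj, fun l hl => (le_argmax f hl).trans hle⟩
  · rintro ⟨hi, hmax, hmin⟩
    refine le_antisymm (Nat.sInf_le ⟨hi, hmax⟩) ?_
    by_contra! hlt
    exact absurd (le_argmax f hi) (not_le.2 (hmin _ (argmax_mem hs f) hlt))

theorem argmax_congr {s : Finset ℕ} {f g : ℕ → ℝ} (h : ∀ i ∈ s, f i = g i) :
    argmax s f = argmax s g := by
  unfold argmax
  congr 1
  ext i
  refine and_congr_right fun hi => forall₂_congr fun j hj => ?_
  rw [h i hi, h j hj]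

@[simp] theorem pad_zero {α : Type} [Zero α] (f : Fin K → α) : pad f 0 = 0 := rfl

theorem pad_succ {α : Type} [Zero α] (f : Fin K → α) (j : Fin K) :
    pad f (j + 1) = f j := by
  simp [pad]

theorem pad_succ' {α : Type} [Zero α] (f : Fin K → α) {j : ℕ} (hj : j < K) :
    pad f (j + 1) = f ⟨j, hj⟩ := by
  simp [pad, hj]

theorem mem_spCandidates {c : Fin K → ℕ} {k b i : ℕ} :
    i ∈ spCandidates c k b ↔ i < k ∧ pad c i + pad c k ≤ b := by
  simp [spCandidates]

section Table

variable (P : Fin U → Fin K → ℝ) (q : Fin U → Fin K) (c : Fin K → ℕ)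

theorem argmax_spCandidates_lt {k b : ℕ} (hk : 0 < k) (f : ℕ → ℝ) :
    argmax (spCandidates c k b) f < k := by
  rcases (spCandidates c k b).eq_empty_or_nonempty with h | h
  · simpa [h] using hk
  · exact (mem_spCandidates.1 (argmax_mem h f)).1

theorem spTable_eq_of_le {k n : ℕ} (h : k ≤ n) : spTable P q c n k = spTable P q c k k := by
  induction n, h using Nat.le_induction with
  | base => rfl
  | succ n hn ih =>
    rw [← ih, spTable, Function.update_of_ne (by omega)]

theorem spF_eq_spTable {k n : ℕ} (hk : k ≤ n) (hn : n ≤ K) (b : ℕ) :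
    spTable P q c n k b = spF P q c k b := by
  rw [spF, spTable_eq_of_le P q c hk, spTable_eq_of_le P q c (hk.trans hn)]

theorem spF_zero (b : ℕ) : spF P q c 0 b = 0 := by
  rw [← spF_eq_spTable P q c le_rfl (Nat.zero_le K)]
  rfl

theorem spF_rec {k : ℕ} (hk : 0 < k) (hK : k ≤ K) (b : ℕ) :
    spF P q c k b =
      spF P q c (spPrev P q c k b) (b - pad c k) + spG P q (spPrev P q c k b) k := by
  obtain ⟨n, rfl⟩ : ∃ n, k = n + 1 := ⟨k - 1, by omega⟩
  rw [← spF_eq_spTable P q c le_rfl hK, spTable, Function.update_self]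
  have key : argmax (spCandidates c (n + 1) b)
      (fun i => spTable P q c n i (b - pad c (n + 1)) + spG P q i (n + 1)) =
      spPrev P q c (n + 1) b := by
    refine argmax_congr fun i hi => ?_
    have := (mem_spCandidates.1 hi).1
    rw [spF_eq_spTable P q c (by omega) (by omega)]
  have hlt := argmax_spCandidates_lt c (b := b) hk
    (fun i => spF P q c i (b - pad c (n + 1)) + spG P q i (n + 1))
  simp only [key]
  rw [spF_eq_spTable P q c (n := n) (by unfold spPrev; omega) (by omega)]

theorem le_spF {k i b : ℕ} (hK : k ≤ K) (hi : i ∈ spCandidates c k b) :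
    spF P q c i (b - pad c k) + spG P q i k ≤ spF P q c k b := by
  have := (mem_spCandidates.1 hi).1
  rw [spF_rec P q c (by omega) hK b]
  exact le_argmax (fun i => spF P q c i (b - pad c k) + spG P q i k) hi

theorem zero_mem_spCandidates {k b : ℕ} (hk : 0 < k) (hb : pad c k ≤ b) :
    0 ∈ spCandidates c k b := by
  simp [mem_spCandidates, hk, hb]

theorem spPrev_mem {k b : ℕ} (hk : 0 < k) (hb : pad c k ≤ b) :
    spPrev P q c k b ∈ spCandidates c k b :=
  argmax_mem ⟨0, zero_mem_spCandidates c hk hb⟩ _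

theorem spPrev_lt {k : ℕ} (b : ℕ) (hk : 0 < k) : spPrev P q c k b < k :=
  argmax_spCandidates_lt c hk _

theorem mem_spBacktrack_bounds {n k b j : ℕ} (hj : j ∈ spBacktrack P q c n k b) :
    1 ≤ j ∧ j ≤ k := by
  induction n generalizing k b with
  | zero => simp [spBacktrack] at hj
  | succ n ih =>
    rw [spBacktrack] at hj
    split_ifs at hj with hk
    · simp at hj
    · rcases Finset.mem_insert.1 hj with rfl | hj
      · omega
      · have := spPrev_lt P q c b (Nat.pos_of_ne_zero hk)
        have := ih hj
        omega

/-- The arms selected by backtracking are affordable. -/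
theorem sum_cost_spBacktrack_le {n k b : ℕ} (hb : pad c k ≤ b) :
    ∑ j ∈ spBacktrack P q c n k b, pad c j ≤ b := by
  induction n generalizing k b with
  | zero => simp [spBacktrack]
  | succ n ih =>
    rw [spBacktrack]
    split_ifs with hk
    · simp
    · have hk0 := Nat.pos_of_ne_zero hk
      have hprev := mem_spCandidates.1 (spPrev_mem P q c hk0 hb)
      rw [Finset.sum_insert]
      · have := ih (k := spPrev P q c k b) (b := b - pad c k) (by omega)
        omega
      · intro hmem
        have := mem_spBacktrack_bounds P q c hmem
        omega

/-- The table entry is at most the value that the backtracked set offers to the users whose peak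
is not beyond the last selected arm. -/
theorem spF_le_of_spBacktrack_le {n k b : ℕ} (hkn : k ≤ n) (hK : k ≤ K) (hb : pad c k ≤ b)
    (v : Fin U → ℝ) (hv0 : ∀ u, 0 ≤ v u)
    (hv : ∀ u, ∀ j ∈ spBacktrack P q c n k b, pad (P u) j ≤ v u) :
    spF P q c k b ≤ ∑ u with (q u : ℕ) + 1 ≤ k, v u := by
  induction n generalizing k b with
  | zero =>
    obtain rfl : k = 0 := by omega
    simp [spF_zero]
  | succ n ih =>
    rcases Nat.eq_zero_or_pos k with rfl | hk
    · simp [spF_zero]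
    have hprev := mem_spCandidates.1 (spPrev_mem P q c hk hb)
    rw [spBacktrack, if_neg hk.ne'] at hv
    have h1 := ih (k := spPrev P q c k b) (b := b - pad c k) (by omega) (by omega) (by omega)
      (fun u j hj => hv u j (Finset.mem_insert_of_mem hj))
    have hk1 : ∀ u, pad (P u) k ≤ v u := fun u => hv u k (Finset.mem_insert_self _ _)
    have hi1 : ∀ u, pad (P u) (spPrev P q c k b) ≤ v u := by
      intro u
      rcases Nat.eq_zero_or_pos (spPrev P q c k b) with h0 | h0
      · rw [h0]; simpa using hv0 u
      · refine hv u _ (Finset.mem_insert_of_mem ?_)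
        obtain ⟨n', rfl⟩ : ∃ n', n = n' + 1 := ⟨n - 1, by omega⟩
        rw [spBacktrack, if_neg h0.ne']
        exact Finset.mem_insert_self _ _
    have h2 : spG P q (spPrev P q c k b) k ≤
        ∑ u with spPrev P q c k b < (q u : ℕ) + 1 ∧ (q u : ℕ) + 1 ≤ k, v u :=
      Finset.sum_le_sum fun u _ => max_le (hi1 u) (hk1 u)
    rw [spF_rec P q c hk hK]
    refine (add_le_add h1 h2).trans (le_of_eq ?_)
    rw [← Finset.sum_union]
    · congr 1
      ext u
      simp only [Finset.mem_union, Finset.mem_filter, Finset.mem_univ, true_and]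
      omega
    · rw [Finset.disjoint_filter]
      intro u _ h
      omega

variable {P q c}

theorem PSPWithPeaks.pad_mono (h : PSPWithPeaks P q) (u : Fin U) {i j : ℕ} (hi : 1 ≤ i)
    (hij : i ≤ j) (hj : j ≤ (q u : ℕ) + 1) : pad (P u) i ≤ pad (P u) j := by
  have hq := (q u).2
  obtain ⟨i, rfl⟩ : ∃ n, i = n + 1 := ⟨i - 1, by omega⟩
  obtain ⟨j, rfl⟩ : ∃ n, j = n + 1 := ⟨j - 1, by omega⟩
  rw [pad_succ' _ (show i < K by omega), pad_succ' _ (show j < K by omega)]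
  refine (h u).1 ?_ ?_ ?_ <;> simp only [Set.mem_Iic, Fin.le_def] <;> omega

theorem PSPWithPeaks.pad_anti (h : PSPWithPeaks P q) (u : Fin U) {i j : ℕ}
    (hi : (q u : ℕ) + 1 ≤ i) (hij : i ≤ j) (hj : j ≤ K) : pad (P u) j ≤ pad (P u) i := by
  obtain ⟨i, rfl⟩ : ∃ n, i = n + 1 := ⟨i - 1, by omega⟩
  obtain ⟨j, rfl⟩ : ∃ n, j = n + 1 := ⟨j - 1, by omega⟩
  rw [pad_succ' _ (show i < K by omega), pad_succ' _ (show j < K by omega)]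
  refine (h u).2 ?_ ?_ ?_ <;> simp only [Set.mem_Ici, Fin.le_def] <;> omega

/-- The table entry bounds the value of every affordable assignment with rightmost arm `k` to the
users whose peak is not beyond `k`. -/
theorem le_spF_of_assignment (hP : PSPWithPeaks P q) (k : ℕ) (hK : k ≤ K) (b : ℕ)
    (S : Finset ℕ) (hkS : k ∈ S) (hS : ∀ j ∈ S, 1 ≤ j ∧ j ≤ k) (hb : ∑ j ∈ S, pad c j ≤ b)
    (g : Fin U → ℕ) (hg : ∀ u, g u ∈ S) :
    ∑ u with (q u : ℕ) + 1 ≤ k, pad (P u) (g u) ≤ spF P q c k b := by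
  induction k using Nat.strong_induction_on generalizing b S g with
  | _ k ih =>
    have hk1 := (hS k hkS).1
    have hsum : pad c k + ∑ j ∈ S.erase k, pad c j ≤ b := by
      rwa [Finset.add_sum_erase _ _ hkS]
    rcases (S.erase k).eq_empty_or_nonempty with he | hne
    · have hgk : ∀ u, g u = k := fun u => by
        by_contra hne
        have : g u ∈ S.erase k := Finset.mem_erase.2 ⟨hne, hg u⟩
        simp [he] at this
      refine le_trans ?_ (le_spF P q c hK
        (zero_mem_spCandidates c hk1 (le_trans (Nat.le_add_right _ _) hsum)))
      rw [spF_zero, zero_add, spG]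
      have hfil : (Finset.univ.filter fun u : Fin U => (q u : ℕ) + 1 ≤ k) =
          Finset.univ.filter fun u => 0 < (q u : ℕ) + 1 ∧ (q u : ℕ) + 1 ≤ k := by
        ext u; simp
      rw [← hfil]
      refine Finset.sum_le_sum fun u _ => ?_
      rw [hgk]
      exact le_max_right _ _
    · set i := (S.erase k).max' hne with hi
      have hiS : i ∈ S.erase k := Finset.max'_mem _ _
      have hmax : ∀ j ∈ S.erase k, j ≤ i := fun j hj => Finset.le_max' _ _ hj
      have hik : i < k := lt_of_le_of_ne (hS i (Finset.mem_of_mem_erase hiS)).2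
        (Finset.ne_of_mem_erase hiS)
      have hi1 := (hS i (Finset.mem_of_mem_erase hiS)).1
      have hci : pad c i ≤ ∑ j ∈ S.erase k, pad c j :=
        Finset.single_le_sum (f := pad c) (fun _ _ => Nat.zero_le _) hiS
      refine le_trans ?_ (le_spF P q c (i := i) hK (mem_spCandidates.2 ⟨hik, by omega⟩))
      have h1 := ih i hik (by omega) (b - pad c k) (S.erase k) hiS
        (fun j hj => ⟨(hS j (Finset.mem_of_mem_erase hj)).1, hmax j hj⟩) (by omega)
        (fun u => if g u = k then i else g u)
        (fun u => by
          by_cases h : g u = k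
          · simpa [h] using hiS
          · simpa [h] using hg u)
      have h2 : ∑ u with i < (q u : ℕ) + 1 ∧ (q u : ℕ) + 1 ≤ k, pad (P u) (g u) ≤
          spG P q i k := by
        refine Finset.sum_le_sum fun u hu => ?_
        simp only [Finset.mem_filter, Finset.mem_univ, true_and] at hu
        by_cases h : g u = k
        · rw [h]; exact le_max_right _ _
        · refine le_trans ?_ (le_max_left _ _)
          exact hP.pad_mono u (hS _ (hg u)).1 (hmax _ (Finset.mem_erase.2 ⟨h, hg u⟩)) hu.1.le
      have h3 : ∑ u with (q u : ℕ) + 1 ≤ i, pad (P u) (g u) ≤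
          ∑ u with (q u : ℕ) + 1 ≤ i, pad (P u) (if g u = k then i else g u) := by
        refine Finset.sum_le_sum fun u hu => ?_
        simp only [Finset.mem_filter, Finset.mem_univ, true_and] at hu
        split_ifs with h
        · rw [h]; exact hP.pad_anti u hu hik.le hK
        · exact le_rfl
      refine le_trans (le_of_eq ?_) (add_le_add (h3.trans h1) h2)
      rw [← Finset.sum_union]
      · congr 1
        ext u
        simp only [Finset.mem_union, Finset.mem_filter, Finset.mem_univ, true_and]
        omega
      · rw [Finset.disjoint_filter]
        intro u _ h
        omega

theorem pad_cost_le {B : ℕ} (hc : ∀ k, c k ≤ B) (k : ℕ) : pad c k ≤ B := by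
  cases k with
  | zero => simp
  | succ k =>
    simp only [pad]
    split_ifs
    · exact hc _
    · exact Nat.zero_le _

theorem spLast_mem (P : Fin U → Fin K → ℝ) (q : Fin U → Fin K) (c : Fin K → ℕ) (B : ℕ)
    (hK : 0 < K) : spLast P q c B ∈ Finset.Icc 1 K :=
  argmax_mem ⟨1, Finset.mem_Icc.2 ⟨le_rfl, hK⟩⟩ _

theorem spLast_mem_spSelected (P : Fin U → Fin K → ℝ) (q : Fin U → Fin K) (c : Fin K → ℕ)
    (B : ℕ) (hK : 0 < K) : spLast P q c B ∈ spSelected P q c B := by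
  have h := Finset.mem_Icc.1 (spLast_mem P q c B hK)
  obtain ⟨n, hn⟩ : ∃ n, K = n + 1 := ⟨K - 1, by omega⟩
  have : spBacktrack P q c K = spBacktrack P q c (n + 1) := by rw [← hn]
  rw [spSelected, this, spBacktrack, if_neg (by omega)]
  exact Finset.mem_insert_self _ _

theorem spSelected_bounds (hK : 0 < K) {B j : ℕ} (hj : j ∈ spSelected P q c B) :
    1 ≤ j ∧ j ≤ K := by
  have := mem_spBacktrack_bounds P q c hj
  have := Finset.mem_Icc.1 (spLast_mem P q c B hK)
  omega

theorem spMatching_add_one (P : Fin U → Fin K → ℝ) (q : Fin U → Fin K) (c : Fin K → ℕ) (B : ℕ)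
    (hK : 0 < K) (u : Fin U) :
    (spMatching P q c B u : ℕ) + 1 = argmax (spSelected P q c B) (pad (P u)) := by
  have h := spSelected_bounds hK
    (argmax_mem ⟨_, spLast_mem_spSelected P q c B hK⟩ (pad (P u)))
  rw [spMatching]
  rw [dif_pos (by omega)]
  simp only
  omega

theorem spMatching_add_one_mem (P : Fin U → Fin K → ℝ) (q : Fin U → Fin K) (c : Fin K → ℕ)
    (B : ℕ) (hK : 0 < K) (u : Fin U) :
    (spMatching P q c B u : ℕ) + 1 ∈ spSelected P q c B := by
  rw [spMatching_add_one P q c B hK]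
  exact argmax_mem ⟨_, spLast_mem_spSelected P q c B hK⟩ _

theorem feasible_spMatching (P : Fin U → Fin K → ℝ) (q : Fin U → Fin K) {B : ℕ} (hK : 0 < K)
    (hc : ∀ k, c k ≤ B) : Feasible c B (spMatching P q c B) := by
  refine le_trans ?_ (sum_cost_spBacktrack_le P q c (n := K) (pad_cost_le hc (spLast P q c B)))
  rw [← Finset.sum_congr rfl fun k _ => pad_succ c k,
    ← Finset.sum_image (f := fun j => pad c j) (g := fun k : Fin K => (k : ℕ) + 1)
      (fun a _ b _ h => Fin.ext (by simpa using h))]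
  refine Finset.sum_le_sum_of_subset fun j hj => ?_
  simp only [Finset.mem_image, Finset.mem_univ, true_and] at hj
  obtain ⟨_, ⟨u, rfl⟩, rfl⟩ := hj
  exact spMatching_add_one_mem P q c B hK u

/-- SP-Matching is optimal on nonnegative single-peaked matrices. -/
theorem value_le_value_spMatching (hP : PSPWithPeaks P q) (hP0 : ∀ u k, 0 ≤ P u k) {B : ℕ}
    (hU : 0 < U) (hK : 0 < K) (hc : ∀ k, c k ≤ B) (π : Matching U K) (hπ : Feasible c B π) :
    value P π ≤ value P (spMatching P q c B) := by
  set S : Finset ℕ := Finset.univ.image fun u => (π u : ℕ) + 1 with hSdef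
  have hne : S.Nonempty := ⟨_, Finset.mem_image_of_mem _ (Finset.mem_univ ⟨0, hU⟩)⟩
  have hgS : ∀ u, (π u : ℕ) + 1 ∈ S := fun u => Finset.mem_image_of_mem _ (Finset.mem_univ u)
  set k := S.max' hne
  have hkS : k ∈ S := Finset.max'_mem _ _
  have hS : ∀ j ∈ S, 1 ≤ j ∧ j ≤ k := fun j hj => by
    refine ⟨?_, Finset.le_max' _ _ hj⟩
    simp only [hSdef, Finset.mem_image] at hj
    omega
  have hkK : k ≤ K := by
    simp only [hSdef, Finset.mem_image] at hkS
    obtain ⟨u, _, hu⟩ := hkS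
    have := (π u).2
    omega
  have hcost : ∑ j ∈ S, pad c j ≤ B := by
    refine le_trans (le_of_eq ?_) hπ
    rw [← Finset.sum_congr rfl fun k _ => pad_succ c k,
      ← Finset.sum_image (f := fun j => pad c j) (g := fun k : Fin K => (k : ℕ) + 1)
      (fun a _ b _ h => Fin.ext (by simpa using h)), Finset.image_image]
    rfl
  have hup := le_spF_of_assignment (c := c) hP k hkK B S hkS hS hcost _ hgS
  have hlast := le_argmax (s := Finset.Icc 1 K)
    (fun k => spF P q c k B + ∑ u with k < (q u : ℕ) + 1, pad (P u) k)
    (Finset.mem_Icc.2 ⟨(hS k hkS).1, hkK⟩)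
  have hl := Finset.mem_Icc.1 (spLast_mem P q c B hK)
  have hv : ∀ u, ∀ j ∈ spSelected P q c B, pad (P u) j ≤ P u (spMatching P q c B u) := by
    intro u j hj
    rw [← pad_succ (P u), spMatching_add_one P q c B hK]
    exact le_argmax _ hj
  have hlow := spF_le_of_spBacktrack_le P q c hl.2 hl.2 (pad_cost_le hc _)
    (fun u => P u (spMatching P q c B u)) (fun u => hP0 _ _) hv
  have hsplit : ∀ (l : ℕ) (f : Fin U → ℝ), ∑ u, f u =
      ∑ u with (q u : ℕ) + 1 ≤ l, f u + ∑ u with l < (q u : ℕ) + 1, f u := fun l f => by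
    rw [← Finset.sum_filter_add_sum_filter_not Finset.univ (fun u => (q u : ℕ) + 1 ≤ l)]
    simp only [not_le]
  calc value P π = ∑ u, pad (P u) ((π u : ℕ) + 1) := by simp only [value, pad_succ]
    _ ≤ spF P q c k B + ∑ u with k < (q u : ℕ) + 1, pad (P u) k := by
      rw [hsplit k]
      refine add_le_add hup (Finset.sum_le_sum fun u hu => ?_)
      simp only [Finset.mem_filter, Finset.mem_univ, true_and] at hu
      exact hP.pad_mono u (by omega) (hS _ (hgS u)).2 hu.le
    _ ≤ _ := hlast
    _ ≤ value P (spMatching P q c B) := by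
      rw [value, hsplit (spLast P q c B)]
      exact add_le_add hlow (Finset.sum_le_sum fun u _ =>
        hv u _ (spLast_mem_spSelected P q c B hK))

end Table

theorem feasible_comp_perm (c : Fin K → ℕ) (B : ℕ) (σ : Equiv.Perm (Fin K))
    (π : Matching U K) :
    Feasible c B (fun u => σ (π u)) ↔ Feasible (fun j => c (σ j)) B π := by
  unfold Feasible
  rw [← Finset.sum_image (f := c) (g := σ) (fun a _ b _ h => σ.injective h),
    Finset.image_image]
  rfl

theorem feasible_mvm (T B : ℕ) (c : Fin K → ℕ) (σ : Equiv.Perm (Fin K)) (p : Fin U → Fin K)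
    (hK : 0 < K) (hc : ∀ k, c k ≤ B) (h : List (Obs U K)) :
    Feasible c B (mvm T B c σ p h) :=
  (feasible_comp_perm c B σ _).2 (feasible_spMatching _ _ hK fun k => hc (σ k))

/-! ### Measurability of Match-via-Maximal -/

section Measurability

variable {Ω : Type*} [MeasurableSpace Ω]

theorem measurable_apply_countable {α β : Type*} [MeasurableSpace α] [Countable α]
    [MeasurableSingletonClass α] [MeasurableSpace β] {x : Ω → α} (hx : Measurable x)
    {g : α → Ω → β} (hg : ∀ a, Measurable (g a)) : Measurable fun ω => g (x ω) ω :=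
  (measurable_from_prod_countable_right (f := fun y : α × Ω => g y.1 y.2) hg).comp
    (hx.prodMk measurable_id)

theorem measurable_argmax (s : Finset ℕ) {f : Ω → ℕ → ℝ} (hf : ∀ i, Measurable fun ω => f ω i) :
    Measurable fun ω => argmax s (f ω) := by
  rcases s.eq_empty_or_nonempty with rfl | hs
  · simp
  refine measurable_to_countable' fun i => ?_
  have : (fun ω => argmax s (f ω)) ⁻¹' {i} = {ω | i ∈ s} ∩
      ((⋂ j ∈ s, {ω | f ω j ≤ f ω i}) ∩ ⋂ j ∈ s, {ω | j < i → f ω j < f ω i}) := by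
    ext ω
    simp [argmax_eq_iff hs]
  rw [this]
  refine (MeasurableSet.const _).inter ((Finset.measurableSet_biInter _ fun j _ =>
    measurableSet_le (hf j) (hf i)).inter (Finset.measurableSet_biInter _ fun j _ => ?_))
  by_cases h : j < i
  · simpa [h] using measurableSet_lt (hf j) (hf i)
  · simp [h]

theorem measurable_pad {P : Ω → Fin K → ℝ} (hP : ∀ k, Measurable fun ω => P ω k) (j : ℕ) :
    Measurable fun ω => pad (P ω) j := by
  cases j with
  | zero => simp
  | succ j =>
    by_cases h : j < K
    · simpa [pad, h] using hP _
    · simp [pad, h]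

variable {P : Ω → Fin U → Fin K → ℝ} (hP : ∀ u k, Measurable fun ω => P ω u k)
  (q : Fin U → Fin K) (c : Fin K → ℕ)

include hP

theorem measurable_spG (i j : ℕ) : Measurable fun ω => spG (P ω) q i j :=
  Finset.measurable_sum _ fun u _ =>
    (measurable_pad (hP u) i).max (measurable_pad (hP u) j)

theorem measurable_spTable (n k b : ℕ) : Measurable fun ω => spTable (P ω) q c n k b := by
  induction n generalizing k b with
  | zero => exact measurable_const
  | succ n ih =>
    simp only [spTable]
    by_cases hk : k = n + 1
    · subst hk
      simp only [Function.update_self]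
      have hf : ∀ i, Measurable fun ω =>
          spTable (P ω) q c n i (b - pad c (n + 1)) + spG (P ω) q i (n + 1) :=
        fun i => (ih _ _).add (measurable_spG hP q _ _)
      exact measurable_apply_countable (measurable_argmax _ hf) hf
    · simpa only [Function.update_of_ne hk] using ih k b

theorem measurable_spF (k b : ℕ) : Measurable fun ω => spF (P ω) q c k b :=
  measurable_spTable hP q c K k b

theorem measurable_spPrev (k b : ℕ) : Measurable fun ω => spPrev (P ω) q c k b :=
  measurable_argmax _ fun _ => (measurable_spF hP q c _ _).add (measurable_spG hP q _ _)

theorem measurable_spLast (B : ℕ) : Measurable fun ω => spLast (P ω) q c B :=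
  measurable_argmax _ fun k => (measurable_spF hP q c _ _).add
    (Finset.measurable_sum _ fun u _ => measurable_pad (hP u) k)

theorem measurable_spBacktrack (n k b : ℕ) :
    Measurable fun ω => spBacktrack (P ω) q c n k b := by
  induction n generalizing k b with
  | zero => exact measurable_const
  | succ n ih =>
    simp only [spBacktrack]
    split_ifs
    · exact measurable_const
    · exact (measurable_of_countable (fun s : Finset ℕ => insert k s)).comp
        (measurable_apply_countable (measurable_spPrev hP q c k b)
          fun k' => ih k' (b - pad c k))

theorem measurable_spSelected (B : ℕ) : Measurable fun ω => spSelected (P ω) q c B :=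
  measurable_apply_countable (measurable_spLast hP q c B)
    fun k => measurable_spBacktrack hP q c K k B

theorem measurable_spMatching (B : ℕ) : Measurable fun ω => spMatching (P ω) q c B :=
  measurable_pi_lambda _ fun u =>
    (measurable_of_countable fun k : ℕ => if h : k - 1 < K then (⟨k - 1, h⟩ : Fin K) else q u).comp
      (measurable_apply_countable (measurable_spSelected hP q c B)
        fun s => measurable_argmax s fun i => measurable_pad (hP u) i)

end Measurability

/-- The sum of the rewards observed for the pair `(u, k)`. -/
def obsSum (h : List (Obs U K)) (u : Fin U) (k : Fin K) : ℝ :=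
  (h.map fun o => if o.1 u = k then o.2 u else 0).sum

theorem empMean_eq (h : List (Obs U K)) (u : Fin U) (k : Fin K) :
    empMean h u k = obsSum h u k / pulls h u k := rfl

@[simp] theorem pulls_nil (u : Fin U) (k : Fin K) : pulls ([] : List (Obs U K)) u k = 0 := rfl

@[simp] theorem obsSum_nil (u : Fin U) (k : Fin K) : obsSum ([] : List (Obs U K)) u k = 0 := rfl

theorem history_succ (A : Policy U K) (r : Rewards U K) (t : ℕ) :
    history A r (t + 1) =
      history A r t ++ [(play A r t, fun u => r (t, u, play A r t u))] := rfl

theorem pulls_append_singleton (h : List (Obs U K)) (o : Obs U K) (u : Fin U) (k : Fin K) :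
    pulls (h ++ [o]) u k = pulls h u k + if o.1 u = k then 1 else 0 := by
  simp [pulls, List.countP_append, List.countP_singleton]

theorem obsSum_append_singleton (h : List (Obs U K)) (o : Obs U K) (u : Fin U) (k : Fin K) :
    obsSum (h ++ [o]) u k = obsSum h u k + if o.1 u = k then o.2 u else 0 := by
  simp [obsSum]

theorem pulls_history_succ (A : Policy U K) (r : Rewards U K) (t : ℕ) (u : Fin U) (k : Fin K) :
    pulls (history A r (t + 1)) u k =
      pulls (history A r t) u k + if play A r t u = k then 1 else 0 := by
  rw [history_succ, pulls_append_singleton]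

theorem obsSum_history_succ (A : Policy U K) (r : Rewards U K) (t : ℕ) (u : Fin U) (k : Fin K) :
    obsSum (history A r (t + 1)) u k =
      obsSum (history A r t) u k + if play A r t u = k then r (t, u, k) else 0 := by
  rw [history_succ, obsSum_append_singleton]
  congr 1
  exact ite_congr rfl (fun h => congrArg (fun j => r (t, u, j)) h) fun _ => rfl

theorem history_congr (A : Policy U K) {r r' : Rewards U K} {t : ℕ}
    (h : ∀ s < t, ∀ u k, r (s, u, k) = r' (s, u, k)) : history A r t = history A r' t := by
  induction t with
  | zero => rfl
  | succ t ih =>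
    have ih := ih fun s hs => h s (by omega)
    simp only [history, ih, h t (Nat.lt_succ_self t)]

theorem play_congr (A : Policy U K) {r r' : Rewards U K} {t : ℕ}
    (h : ∀ s < t, ∀ u k, r (s, u, k) = r' (s, u, k)) : play A r t = play A r' t := by
  rw [play, play, history_congr A h]

section StatsMeasurability

variable {Ω : Type*} [MeasurableSpace Ω] {H : Ω → List (Obs U K)}
  (hp : ∀ u k, Measurable fun ω => pulls (H ω) u k)
  (hs : ∀ u k, Measurable fun ω => obsSum (H ω) u k)

include hp in
theorem measurable_radius (T : ℕ) (u : Fin U) (k : Fin K) :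
    Measurable fun ω => radius T (H ω) u k :=
  (measurable_of_countable fun n : ℕ => √(2 * Real.log T / (max 1 n : ℕ))).comp (hp u k)

include hp hs

theorem measurable_empMean (u : Fin U) (k : Fin K) :
    Measurable fun ω => empMean (H ω) u k :=
  (hs u k).div ((measurable_of_countable fun n : ℕ => (n : ℝ)).comp (hp u k))

theorem measurable_maximalMatrix (T : ℕ) (σ : Equiv.Perm (Fin K)) (p : Fin U → Fin K)
    (u : Fin U) (k : Fin K) : Measurable fun ω => maximalMatrix T σ p (H ω) u k := by
  have h : ∀ j, Measurable fun ω => ucb T (H ω) u (σ j) := fun j =>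
    (measurable_empMean hp hs u _).add (measurable_radius hp T u _)
  have : (fun ω => maximalMatrix T σ p (H ω) u k) =
      (Finset.uIcc (σ.symm k) (σ.symm (p u))).inf' Finset.nonempty_uIcc
        fun j ω => ucb T (H ω) u (σ j) := by
    ext ω
    rw [Finset.inf'_apply, maximalMatrix]
  rw [this]
  exact Finset.inf'_induction Finset.nonempty_uIcc _ (fun f hf g hg => hf.inf hg)
    fun j _ => h j

theorem measurable_mvm (T B : ℕ) (c : Fin K → ℕ) (σ : Equiv.Perm (Fin K)) (p : Fin U → Fin K) :
    Measurable fun ω => mvm T B c σ p (H ω) :=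
  (measurable_of_countable fun π : Matching U K => fun u => σ (π u)).comp
    (measurable_spMatching (fun u j => measurable_maximalMatrix hp hs T σ p u (σ j)) _ _ B)

end StatsMeasurability

/-- The matching is determined measurably in every round. -/
def Policy.IsMeasurable (A : Policy U K) : Prop := ∀ t, Measurable fun r => play A r t

section

variable {A : Policy U K}

theorem measurable_pulls_of_play {t : ℕ} (hA : ∀ s < t, Measurable fun r => play A r s)
    (u : Fin U) (k : Fin K) : Measurable fun r => pulls (history A r t) u k := by
  induction t with
  | zero => exact measurable_const
  | succ t ih =>
    simp only [pulls_history_succ]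
    exact (ih fun s hs => hA s (by omega)).add ((measurable_of_countable
      fun π : Matching U K => if π u = k then 1 else 0).comp (hA t (Nat.lt_succ_self t)))

theorem measurable_obsSum_of_play {t : ℕ} (hA : ∀ s < t, Measurable fun r => play A r s)
    (u : Fin U) (k : Fin K) : Measurable fun r => obsSum (history A r t) u k := by
  induction t with
  | zero => exact measurable_const
  | succ t ih =>
    simp only [obsSum_history_succ]
    refine (ih fun s hs => hA s (by omega)).add (Measurable.ite ?_ (measurable_pi_apply _)
      measurable_const)
    exact (hA t (Nat.lt_succ_self t)) (Set.Finite.measurableSet (Set.toFinite {π | π u = k}))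

theorem Policy.IsMeasurable.pulls (hA : A.IsMeasurable) (t : ℕ) (u : Fin U) (k : Fin K) :
    Measurable fun r => pulls (history A r t) u k :=
  measurable_pulls_of_play (fun s _ => hA s) u k

theorem Policy.IsMeasurable.obsSum (hA : A.IsMeasurable) (t : ℕ) (u : Fin U) (k : Fin K) :
    Measurable fun r => obsSum (history A r t) u k :=
  measurable_obsSum_of_play (fun s _ => hA s) u k

theorem isMeasurable_mvm (T B : ℕ) (c : Fin K → ℕ) (σ : Equiv.Perm (Fin K))
    (p : Fin U → Fin K) : (mvm T B c σ p).IsMeasurable := by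
  intro t
  induction t using Nat.strong_induction_on with
  | _ t ih =>
    exact measurable_mvm (measurable_pulls_of_play ih) (measurable_obsSum_of_play ih) T B c σ p

end

/-! ### The reward process -/

open ProbabilityTheory

instance (I : Instance U K) : IsProbabilityMeasure I.rewardLaw :=
  inferInstanceAs (IsProbabilityMeasure (Measure.infinitePi _))

namespace Instance

variable (I : Instance U K)

theorem measurePreserving_reward (x : ℕ × Fin U × Fin K) :
    MeasurePreserving (fun r : Rewards U K => r x) I.rewardLaw (I.D x.2.1 x.2.2) :=
  measurePreserving_eval_infinitePi (fun x : ℕ × Fin U × Fin K => I.D x.2.1 x.2.2) x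

theorem ae_mem_Icc (u : Fin U) (k : Fin K) : ∀ᵐ y ∂I.D u k, y ∈ Set.Icc (0 : ℝ) 1 :=
  (prob_compl_eq_zero_iff measurableSet_Icc).2 (I.supported u k)

theorem Θ_mem_Icc (u : Fin U) (k : Fin K) : I.Θ u k ∈ Set.Icc (0 : ℝ) 1 := by
  have h := I.ae_mem_Icc u k
  refine ⟨integral_nonneg_of_ae (h.mono fun y hy => hy.1), ?_⟩
  refine (integral_mono_ae (Integrable.of_mem_Icc 0 1 aemeasurable_id h) (integrable_const 1)
    (h.mono fun y hy => hy.2)).trans ?_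
  simp

theorem integrable_reward (x : ℕ × Fin U × Fin K) :
    Integrable (fun r : Rewards U K => r x) I.rewardLaw :=
  Integrable.of_mem_Icc 0 1 (measurable_pi_apply x).aemeasurable
    ((I.measurePreserving_reward x).quasiMeasurePreserving.ae (I.ae_mem_Icc _ _))

theorem integral_reward (t : ℕ) (u : Fin U) (k : Fin K) :
    ∫ r : Rewards U K, r (t, u, k) ∂I.rewardLaw = I.Θ u k := by
  rw [Θ, ← (I.measurePreserving_reward (t, u, k)).map_eq]
  exact (integral_map (φ := fun r : Rewards U K => r (t, u, k)) (f := fun y : ℝ => y)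
    (measurable_pi_apply (t, u, k)).aemeasurable measurable_id.aestronglyMeasurable).symm

/-- What is determined by the rewards of the rounds before `t` is independent of the rewards of
round `t`. -/
theorem indepFun_reward {β : Type*} [MeasurableSpace β] {φ : Rewards U K → β} {t : ℕ}
    (hφ : Measurable φ)
    (hpast : ∀ r r' : Rewards U K, (∀ s < t, ∀ u k, r (s, u, k) = r' (s, u, k)) → φ r = φ r')
    (u : Fin U) (k : Fin K) : IndepFun φ (fun r => r (t, u, k)) I.rewardLaw := by
  classical
  set S : Finset (ℕ × Fin U × Fin K) := Finset.range t ×ˢ Finset.univ with hS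
  have hind : iIndepFun (fun (i : ℕ × Fin U × Fin K) (r : Rewards U K) => r i) I.rewardLaw :=
    iIndepFun_infinitePi (P := fun x : ℕ × Fin U × Fin K => I.D x.2.1 x.2.2)
      (X := fun _ y => y) fun _ => measurable_id
  have h := hind.indepFun_finset S {(t, u, k)} (by simp [hS]) fun i => measurable_pi_apply i
  set E : (S → ℝ) → Rewards U K := fun y i => if h : i ∈ S then y ⟨i, h⟩ else 0 with hE
  have hEm : Measurable E := measurable_pi_lambda _ fun i => by
    by_cases hi : i ∈ S
    · simpa [hE, hi] using measurable_pi_apply _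
    · simp [hE, hi]
  have h' := h.comp (hφ.comp hEm)
    (measurable_pi_apply (⟨(t, u, k), Finset.mem_singleton_self _⟩ :
      ({(t, u, k)} : Finset (ℕ × Fin U × Fin K))))
  convert h' using 1
  swap
  · rfl
  ext1 r
  refine hpast _ _ fun s hs v j => ?_
  have : (s, v, j) ∈ S := by simp [hS, hs]
  simp [hE, this]

/-- Hoeffding's lemma for a centered reward. -/
theorem lintegral_exp_reward_le (u : Fin U) (k : Fin K) (l : ℝ) :
    ∫⁻ y, ENNReal.ofReal (Real.exp (l * (y - I.Θ u k) - l ^ 2 / 8)) ∂I.D u k ≤ 1 := by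
  have h : HasSubgaussianMGF (fun y => y - I.Θ u k) ((‖(1 : ℝ) - 0‖₊ / 2) ^ 2) (I.D u k) :=
    hasSubgaussianMGF_of_mem_Icc (X := fun y : ℝ => y) aemeasurable_id (I.ae_mem_Icc u k)
  have hle := h.mgf_le l
  have hint := h.integrable_exp_mul l
  have heq : ∀ y : ℝ, Real.exp (l * (y - I.Θ u k) - l ^ 2 / 8) =
      Real.exp (l * (y - I.Θ u k)) * Real.exp (-(l ^ 2 / 8)) := fun y => by
    rw [← Real.exp_add]; ring_nf
  simp only [heq]
  rw [← ofReal_integral_eq_lintegral_ofReal (hint.mul_const _)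
    (Filter.Eventually.of_forall fun y => by positivity), integral_mul_const]
  refine ENNReal.ofReal_le_one.2 ?_
  rw [Real.exp_neg, ← div_eq_mul_inv, div_le_one (Real.exp_pos _)]
  refine hle.trans (le_of_eq ?_)
  congr 1
  simp
  ring

end Instance

/-- The total deviation of the rewards observed for `(u, k)` from the value `m`. -/
def obsDev (m : ℝ) (h : List (Obs U K)) (u : Fin U) (k : Fin K) : ℝ :=
  obsSum h u k - pulls h u k * m

/-- The exponential supermartingale of Hoeffding's inequality. -/
noncomputable def expProcess (l m : ℝ) (h : List (Obs U K)) (u : Fin U) (k : Fin K) :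
    ENNReal :=
  ENNReal.ofReal (Real.exp (l * obsDev m h u k - pulls h u k * (l ^ 2 / 8)))

theorem expProcess_history_succ (A : Policy U K) (r : Rewards U K) (l m : ℝ) (t : ℕ)
    (u : Fin U) (k : Fin K) :
    expProcess l m (history A r (t + 1)) u k =
      (if play A r t u = k then 0 else expProcess l m (history A r t) u k) +
      (if play A r t u = k then expProcess l m (history A r t) u k else 0) *
        ENNReal.ofReal (Real.exp (l * (r (t, u, k) - m) - l ^ 2 / 8)) := by
  unfold expProcess obsDev
  rw [pulls_history_succ, obsSum_history_succ]
  split_ifs with h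
  · rw [zero_add, ← ENNReal.ofReal_mul (Real.exp_pos _).le, ← Real.exp_add]
    congr 2
    push_cast
    ring
  · simp

section Concentration

variable (I : Instance U K) {A : Policy U K} (hA : A.IsMeasurable)

include hA

theorem measurable_expProcess (l m : ℝ) (t : ℕ) (u : Fin U) (k : Fin K) :
    Measurable fun r => expProcess l m (history A r t) u k := by
  have hp : Measurable fun r => (pulls (history A r t) u k : ℝ) :=
    (measurable_of_countable fun n : ℕ => (n : ℝ)).comp (hA.pulls t u k)
  have hs := hA.obsSum t u k
  unfold expProcess obsDev
  fun_prop

theorem measurableSet_play (t : ℕ) (u : Fin U) (k : Fin K) :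
    MeasurableSet {r | play A r t u = k} :=
  hA t (Set.Finite.measurableSet (Set.toFinite {π : Matching U K | π u = k}))

theorem lintegral_expProcess_le (l : ℝ) (t : ℕ) (u : Fin U) (k : Fin K) :
    ∫⁻ r, expProcess l (I.Θ u k) (history A r t) u k ∂I.rewardLaw ≤ 1 := by
  induction t with
  | zero => simp [expProcess, obsDev, history]
  | succ t ih =>
    have hM := measurable_expProcess hA l (I.Θ u k) t u k
    have hplay := measurableSet_play hA t u k
    have h0 : Measurable fun r : Rewards U K => if play A r t u = k then (0 : ENNReal)
        else expProcess l (I.Θ u k) (history A r t) u k := Measurable.ite hplay measurable_const hM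
    have h1 : Measurable fun r : Rewards U K => if play A r t u = k then
        expProcess l (I.Θ u k) (history A r t) u k else 0 := Measurable.ite hplay hM measurable_const
    have hψ : Measurable fun y : ℝ =>
        ENNReal.ofReal (Real.exp (l * (y - I.Θ u k) - l ^ 2 / 8)) := by fun_prop
    have hind := (I.indepFun_reward h1 (t := t) (fun r r' h => by
      rw [play_congr A h, history_congr A h]) u k).comp measurable_id hψ
    simp only [expProcess_history_succ]
    rw [lintegral_add_left h0]
    have hmul := lintegral_mul_eq_lintegral_mul_lintegral_of_indepFun'' h1.aemeasurable
      (hψ.comp (measurable_pi_apply (t, u, k))).aemeasurable hind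
    simp only [Function.comp_apply] at hmul
    rw [hmul]
    have hE : ∫⁻ r : Rewards U K,
        ENNReal.ofReal (Real.exp (l * (r (t, u, k) - I.Θ u k) - l ^ 2 / 8)) ∂I.rewardLaw ≤ 1 := by
      rw [(I.measurePreserving_reward (t, u, k)).lintegral_comp hψ]
      exact I.lintegral_exp_reward_le u k l
    refine (add_le_add_right (mul_le_of_le_one_right' hE) _).trans ?_
    rw [← lintegral_add_left h0]
    refine le_trans (lintegral_mono fun r => ?_) ih
    split_ifs <;> simp

/-- Hoeffding's inequality for an adaptively sampled arm, in terms of a one-sided deviation. -/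
theorem measure_pulls_eq_le (l a : ℝ) (t n : ℕ) (u : Fin U) (k : Fin K) :
    I.rewardLaw {r | pulls (history A r t) u k = n ∧
        a ≤ l * obsDev (I.Θ u k) (history A r t) u k} ≤
      ENNReal.ofReal (Real.exp (n * (l ^ 2 / 8) - a)) := by
  set ε : ENNReal := ENNReal.ofReal (Real.exp (a - n * (l ^ 2 / 8))) with hε
  have hmarkov := mul_meas_ge_le_lintegral (μ := I.rewardLaw)
    (measurable_expProcess hA l (I.Θ u k) t u k) ε
  have hinv : ENNReal.ofReal (Real.exp (n * (l ^ 2 / 8) - a)) * ε = 1 := by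
    rw [hε, ← ENNReal.ofReal_mul (Real.exp_pos _).le, ← Real.exp_add]
    simp
  calc _ ≤ I.rewardLaw {r | ε ≤ expProcess l (I.Θ u k) (history A r t) u k} := by
        refine measure_mono fun r hr => ?_
        obtain ⟨hn, ha⟩ := hr
        simp only [Set.mem_ofPred_eq, expProcess, hε, hn]
        gcongr
    _ = ENNReal.ofReal (Real.exp (n * (l ^ 2 / 8) - a)) *
        (ε * I.rewardLaw {r | ε ≤ expProcess l (I.Θ u k) (history A r t) u k}) := by
        rw [← mul_assoc, hinv, one_mul]
    _ ≤ _ := mul_le_of_le_one_right' (hmarkov.trans (lintegral_expProcess_le I hA l t u k))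

end Concentration

/-! ### The regret of Match-via-Maximal -/

theorem sum_pulls_history (A : Policy U K) (r : Rewards U K) (t : ℕ) (u : Fin U) :
    ∑ k, pulls (history A r t) u k = t := by
  induction t with
  | zero => simp [history]
  | succ t ih => simp [pulls_history_succ, Finset.sum_add_distrib, ih]

theorem pulls_history_le (A : Policy U K) (r : Rewards U K) (t : ℕ) (u : Fin U) (k : Fin K) :
    pulls (history A r t) u k ≤ t :=
  (Finset.single_le_sum (f := fun k => pulls (history A r t) u k) (fun _ _ => Nat.zero_le _)
    (Finset.mem_univ k)).trans (sum_pulls_history A r t u).le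

theorem one_le_two_mul_log {T : ℕ} (hT : 2 ≤ T) : 1 ≤ 2 * Real.log T := by
  have h1 := Real.log_two_gt_d9
  have h2 : Real.log 2 ≤ Real.log T := Real.log_le_log (by norm_num) (by exact_mod_cast hT)
  linarith

/-- The true mean lies outside the confidence interval of the pair `(u, k)`. -/
def Deviates (T : ℕ) (m : ℝ) (h : List (Obs U K)) (u : Fin U) (k : Fin K) : Prop :=
  radius T h u k < |empMean h u k - m|

theorem Deviates.pulls_pos {T : ℕ} (hT : 2 ≤ T) {m : ℝ} (hm : m ∈ Set.Icc (0 : ℝ) 1)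
    {h : List (Obs U K)} {u : Fin U} {k : Fin K} (hd : Deviates T m h u k) :
    0 < pulls h u k := by
  by_contra! h0
  have h0 : pulls h u k = 0 := by omega
  unfold Deviates at hd
  rw [empMean_eq, radius, h0] at hd
  have h1 : (1 : ℝ) ≤ √(2 * Real.log T) := Real.one_le_sqrt.2 (one_le_two_mul_log hT)
  rw [Real.sqrt_mul (by norm_num)] at h1
  simp [abs_of_nonneg hm.1] at hd
  linarith [hm.2]

theorem Deviates.le_mul_obsDev {T : ℕ} (hT : 2 ≤ T) {m : ℝ} {h : List (Obs U K)} {u : Fin U}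
    {k : Fin K} (hd : Deviates T m h u k) (hn : 0 < pulls h u k) :
    8 * Real.log T ≤ 4 * √(2 * Real.log T / pulls h u k) * obsDev m h u k ∨
    8 * Real.log T ≤ -(4 * √(2 * Real.log T / pulls h u k)) * obsDev m h u k := by
  unfold Deviates at hd
  rw [empMean_eq, radius, max_eq_right hn] at hd
  unfold obsDev
  have hn' : (0 : ℝ) < pulls h u k := by exact_mod_cast hn
  set n : ℝ := (pulls h u k : ℝ)
  set ε := √(2 * Real.log T / n) with hε
  have hlog : 0 ≤ 2 * Real.log T / n := div_nonneg (by linarith [one_le_two_mul_log hT]) hn'.le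
  have hsq : ε * ε * n = 2 * Real.log T := by
    rw [hε, Real.mul_self_sqrt hlog]; field_simp
  have hε0 : 0 ≤ ε := Real.sqrt_nonneg _
  have hdev : obsSum h u k / n - m = (obsSum h u k - n * m) / n := by field_simp
  rw [hdev, abs_div, abs_of_pos hn', lt_div_iff₀ hn'] at hd
  rcases le_total 0 (obsSum h u k - n * m) with hs | hs
  · rw [abs_of_nonneg hs] at hd
    left
    nlinarith [mul_le_mul_of_nonneg_left hd.le hε0]
  · rw [abs_of_nonpos hs] at hd
    right
    nlinarith [mul_le_mul_of_nonneg_left hd.le hε0]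

section Concentration

variable (I : Instance U K) {A : Policy U K} (hA : A.IsMeasurable)

include hA

theorem measurableSet_deviates (T : ℕ) (m : ℝ) (t : ℕ) (u : Fin U) (k : Fin K) :
    MeasurableSet {r | Deviates T m (history A r t) u k} :=
  measurableSet_lt (measurable_radius (hA.pulls t) T u k)
    ((measurable_empMean (hA.pulls t) (hA.obsSum t) u k).sub_const m).abs

theorem measure_deviates_le {T : ℕ} (hT : 2 ≤ T) (t : ℕ) (u : Fin U) (k : Fin K) :
    I.rewardLaw.real {r | Deviates T (I.Θ u k) (history A r t) u k} ≤ t * (2 / T ^ 4) := by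
  have hT0 : (0 : ℝ) < T := by exact_mod_cast (by omega : 0 < T)
  set E : ℝ → ℕ → Set (Rewards U K) := fun s n => {r | pulls (history A r t) u k = n ∧
    8 * Real.log T ≤ s * (4 * √(2 * Real.log T / n)) * obsDev (I.Θ u k) (history A r t) u k}
  have hE : ∀ s : ℝ, s ^ 2 = 1 → ∀ n ∈ Finset.Icc 1 t,
      I.rewardLaw.real (E s n) ≤ 1 / T ^ 4 := by
    intro s hs n hn
    have hn' : (0 : ℝ) < n := by exact_mod_cast (Finset.mem_Icc.1 hn).1
    have hlog : 0 ≤ 2 * Real.log T / n := div_nonneg (by linarith [one_le_two_mul_log hT]) hn'.le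
    refine ENNReal.toReal_le_of_le_ofReal (by positivity)
      ((measure_pulls_eq_le I hA _ _ t n u k).trans (le_of_eq ?_))
    congr 1
    rw [mul_pow, mul_pow, hs, Real.sq_sqrt hlog, one_div, ← Real.exp_log (pow_pos hT0 4),
      ← Real.exp_neg, Real.log_pow]
    congr 1
    field_simp
    ring
  have hsub : {r | Deviates T (I.Θ u k) (history A r t) u k} ⊆
      ⋃ n ∈ Finset.Icc 1 t, (E 1 n ∪ E (-1) n) := by
    intro r hr
    have hpos := Deviates.pulls_pos hT (I.Θ_mem_Icc u k) hr
    simp only [Set.mem_iUnion]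
    refine ⟨pulls (history A r t) u k,
      Finset.mem_Icc.2 ⟨hpos, pulls_history_le A r t u k⟩, ?_⟩
    rcases Deviates.le_mul_obsDev hT hr hpos with h | h
    · exact Or.inl ⟨rfl, by rwa [one_mul]⟩
    · exact Or.inr ⟨rfl, by rwa [neg_one_mul]⟩
  calc I.rewardLaw.real {r | Deviates T (I.Θ u k) (history A r t) u k}
      ≤ I.rewardLaw.real (⋃ n ∈ Finset.Icc 1 t, (E 1 n ∪ E (-1) n)) :=
      measureReal_mono hsub (measure_ne_top _ _)
    _ ≤ ∑ n ∈ Finset.Icc 1 t, I.rewardLaw.real (E 1 n ∪ E (-1) n) :=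
      measureReal_biUnion_finset_le _ _
    _ ≤ ∑ n ∈ Finset.Icc 1 t, (2 / T ^ 4 : ℝ) := by
      refine Finset.sum_le_sum fun n hn => (measureReal_union_le _ _).trans ?_
      have h1 := hE 1 (by norm_num) n hn
      have h2 := hE (-1) (by norm_num) n hn
      calc _ ≤ (1 / T ^ 4 + 1 / T ^ 4 : ℝ) := add_le_add h1 h2
        _ = _ := by ring
    _ = t * (2 / T ^ 4) := by simp

theorem measure_exists_deviates_le {T : ℕ} (hT : 2 ≤ T) (hU : U ≤ T) (hK : K ≤ T) {t : ℕ}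
    (ht : t ≤ T) :
    I.rewardLaw.real {r | ∃ u k, Deviates T (I.Θ u k) (history A r t) u k} ≤ 2 / T := by
  have hT0 : (0 : ℝ) < T := by exact_mod_cast (by omega : 0 < T)
  have heq : {r | ∃ u k, Deviates T (I.Θ u k) (history A r t) u k} =
      ⋃ x ∈ (Finset.univ : Finset (Fin U × Fin K)),
        {r | Deviates T (I.Θ x.1 x.2) (history A r t) x.1 x.2} := by
    ext r; simp
  rw [heq]
  refine (measureReal_biUnion_finset_le _ _).trans
    ((Finset.sum_le_sum fun x _ => measure_deviates_le I hA hT t x.1 x.2).trans ?_)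
  rw [Finset.sum_const, nsmul_eq_mul, Finset.card_univ, Fintype.card_prod, Fintype.card_fin,
    Fintype.card_fin, Nat.cast_mul]
  have hU' : (U : ℝ) ≤ T := by exact_mod_cast hU
  have hK' : (K : ℝ) ≤ T := by exact_mod_cast hK
  have ht' : (t : ℝ) ≤ T := by exact_mod_cast ht
  calc (U * K * (t * (2 / T ^ 4)) : ℝ) ≤ T * T * (T * (2 / T ^ 4)) := by gcongr
    _ = 2 / T := by field_simp

theorem integral_reward_play (t : ℕ) (u : Fin U) :
    ∫ r, r (t, u, play A r t u) ∂I.rewardLaw = ∫ r, I.Θ u (play A r t u) ∂I.rewardLaw := by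
  have hind : ∀ k, Measurable fun r : Rewards U K => if play A r t u = k then (1 : ℝ) else 0 :=
    fun k => Measurable.ite (measurableSet_play hA t u k) measurable_const measurable_const
  have hindep := fun k => I.indepFun_reward (hind k) (t := t)
    (fun r r' h => by rw [play_congr A h]) u k
  have hint : ∀ k, Integrable (fun r : Rewards U K => if play A r t u = k then (1 : ℝ) else 0)
      I.rewardLaw := fun k => Integrable.of_bound (hind k).aestronglyMeasurable 1
    (Filter.Eventually.of_forall fun r => by split_ifs <;> simp)
  have h1 : ∀ r : Rewards U K, r (t, u, play A r t u) =
      ∑ k, (if play A r t u = k then (1 : ℝ) else 0) * r (t, u, k) := fun r => by simp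
  have h2 : ∀ r : Rewards U K, I.Θ u (play A r t u) =
      ∑ k, (if play A r t u = k then (1 : ℝ) else 0) * I.Θ u k := fun r => by simp
  simp only [h1, h2]
  rw [integral_finsetSum, integral_finsetSum]
  · refine Finset.sum_congr rfl fun k _ => ?_
    rw [(hindep k).integral_fun_mul_eq_mul_integral (hind k).aestronglyMeasurable
      (I.integrable_reward _).aestronglyMeasurable, integral_mul_const, I.integral_reward]
  · exact fun k _ => (hint k).mul_const _
  · exact fun k _ => (hindep k).integrable_mul (hint k) (I.integrable_reward _)

theorem integrable_reward_play (t : ℕ) (u : Fin U) :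
    Integrable (fun r => r (t, u, play A r t u)) I.rewardLaw := by
  have h1 : ∀ r : Rewards U K, r (t, u, play A r t u) =
      ∑ k, {r | play A r t u = k}.indicator (fun r => r (t, u, k)) r := fun r => by
    simp [Set.indicator_apply]
  simp only [h1]
  exact integrable_finsetSum _ fun k _ =>
    (I.integrable_reward _).indicator (measurableSet_play hA t u k)

theorem integrable_play (f : Matching U K → ℝ) (t : ℕ) :
    Integrable (fun r => f (play A r t)) I.rewardLaw :=
  Integrable.of_bound ((measurable_of_countable f).comp (hA t)).aestronglyMeasurable
    (∑ π, ‖f π‖) (Filter.Eventually.of_forall fun _ =>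
      Finset.single_le_sum (f := fun π => ‖f π‖) (fun _ _ => norm_nonneg _) (Finset.mem_univ _))

theorem regret_eq_integral_gap :
    I.regret A =
      ∫ r, ∑ t ∈ Finset.range I.T, (I.opt - value I.Θ (play A r t)) ∂I.rewardLaw := by
  rw [Instance.regret, integral_finsetSum _ fun t _ => integrable_finsetSum _ fun u _ =>
    integrable_reward_play I hA t u, integral_finsetSum _ fun t _ =>
    integrable_play I hA (fun π => I.opt - value I.Θ π) t]
  have h : ∀ t, ∫ r, (I.opt - value I.Θ (play A r t)) ∂I.rewardLaw =
      I.opt - ∫ r, ∑ u, r (t, u, play A r t u) ∂I.rewardLaw := fun t => by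
    rw [integral_sub (integrable_const _) (integrable_play I hA _ t),
      integral_finsetSum _ fun u _ => integrable_reward_play I hA t u]
    simp only [integral_reward_play I hA]
    rw [← integral_finsetSum _ fun u _ => integrable_play I hA (fun π => I.Θ u (π u)) t]
    simp [value]
  simp only [h]
  simp

end Concentration

section Gap

variable (I : Instance U K)

theorem Instance.exists_opt (hK : 0 < K) :
    ∃ π : Matching U K, Feasible I.c I.B π ∧ value I.Θ π = I.opt := by
  have hne : (value I.Θ '' {π : Matching U K | Feasible I.c I.B π}).Nonempty := by
    refine ⟨_, (fun _ => ⟨0, hK⟩ : Matching U K), ?_, rfl⟩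
    have hsub : Finset.univ.image (fun _ : Fin U => (⟨0, hK⟩ : Fin K)) ⊆ {⟨0, hK⟩} := by
      intro k hk
      simp only [Finset.mem_image] at hk
      obtain ⟨_, _, rfl⟩ := hk
      exact Finset.mem_singleton_self _
    exact (Finset.sum_le_sum_of_subset (f := I.c) hsub).trans (by simpa using I.cost_le _)
  obtain ⟨π, hπ, h⟩ := hne.csSup_mem ((Set.toFinite _).image _)
  exact ⟨π, hπ, h⟩

theorem Instance.gap_le (hK : 0 < K) (π : Matching U K) : I.opt - value I.Θ π ≤ U := by
  obtain ⟨π', -, h⟩ := I.exists_opt hK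
  rw [← h]
  have h1 : value I.Θ π' ≤ ∑ _u : Fin U, (1 : ℝ) :=
    Finset.sum_le_sum fun u _ => (I.Θ_mem_Icc u _).2
  have h2 : 0 ≤ value I.Θ π := Finset.sum_nonneg fun u _ => (I.Θ_mem_Icc u _).1
  simp at h1
  linarith

theorem value_mono {M N : Fin U → Fin K → ℝ} (h : ∀ u k, M u k ≤ N u k) (π : Matching U K) :
    value M π ≤ value N π := Finset.sum_le_sum fun u _ => h u _

theorem gap_mvm_le (hU : 0 < U) (hK : 0 < K) {σ : Equiv.Perm (Fin K)} {p : Fin U → Fin K}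
    (hΘ : SPWithPeaks σ p I.Θ) {h : List (Obs U K)}
    (hgood : ∀ u k, ¬ Deviates I.T (I.Θ u k) h u k) :
    I.opt - value I.Θ (mvm I.T I.B I.c σ p h) ≤
      ∑ u, 2 * radius I.T h u (mvm I.T I.B I.c σ p h u) := by
  have hmem : I.Θ ∈ confidenceSet I.T σ p h := by
    refine ⟨hΘ, fun u k => ?_⟩
    have := abs_le.1 (not_lt.1 (hgood u k))
    constructor <;> simp only [lcb, ucb] <;> linarith
  have hgr := isGreatest_maximalMatrix I.T σ p h ⟨_, hmem⟩
  set M := maximalMatrix I.T σ p h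
  have hΘM : ∀ u k, I.Θ u k ≤ M u k := fun u k => hgr.2 hmem u k
  obtain ⟨π, hπ, hopt⟩ := I.exists_opt hK
  have h1 : value M π = value (fun v j => M v (σ j)) fun u => σ.symm (π u) := by simp [value]
  have h2 := value_le_value_spMatching (P := fun v j => M v (σ j))
    (q := fun v => σ.symm (p v)) (c := fun j => I.c (σ j)) hgr.1.1
    (fun u k => (I.Θ_mem_Icc u _).1.trans (hΘM u _)) hU hK (fun k => I.cost_le _)
    (fun u => σ.symm (π u)) ((feasible_comp_perm I.c I.B σ _).1 (by simpa using hπ))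
  have h3 : value M (mvm I.T I.B I.c σ p h) ≤
      value I.Θ (mvm I.T I.B I.c σ p h) + ∑ u, 2 * radius I.T h u (mvm I.T I.B I.c σ p h u) := by
    rw [value, value, ← Finset.sum_add_distrib]
    refine Finset.sum_le_sum fun u _ => ((hgr.1.2 u _).2).trans ?_
    have := abs_le.1 (not_lt.1 (hgood u (mvm I.T I.B I.c σ p h u)))
    simp only [ucb]
    linarith
  have h4 := value_mono hΘM π
  have h5 : value M (mvm I.T I.B I.c σ p h) = value (fun v j => M v (σ j))
    (spMatching (fun v j => M v (σ j)) (fun v => σ.symm (p v)) (fun j => I.c (σ j)) I.B) := rfl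
  linarith

theorem sqrt_succ_bound (n : ℕ) :
    3 * √n + 1 / √(max 1 n : ℕ) ≤ 3 * √(n + 1 : ℕ) := by
  rcases Nat.eq_zero_or_pos n with rfl | hn
  · norm_num
  rw [max_eq_right hn]
  have hn' : (0 : ℝ) < n := by exact_mod_cast hn
  have ha := Real.sqrt_pos.2 hn'
  have h1 := Real.sq_sqrt hn'.le
  have h2 := Real.sq_sqrt (Nat.cast_nonneg (α := ℝ) (n + 1))
  have hb := Real.sqrt_nonneg ((n + 1 : ℕ) : ℝ)
  push_cast at h2 hb ⊢
  set a := √(n : ℝ)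
  set b := √((n : ℝ) + 1)
  have hn1 : (1 : ℝ) ≤ n := by exact_mod_cast hn
  have hb2 : b ≤ 2 * a := by nlinarith
  have hab : (b - a) * (b + a) = 1 := by nlinarith
  have : 1 / a ≤ 3 * (b - a) := by
    rw [div_le_iff₀ ha]
    nlinarith
  linarith

theorem sum_radius_le (A : Policy U K) (r : Rewards U K) (T t : ℕ) (u : Fin U) :
    ∑ s ∈ Finset.range t, radius T (history A r s) u (play A r s u) ≤
      √(2 * Real.log T) * ∑ k, 3 * √(pulls (history A r t) u k) := by
  induction t with
  | zero => simp [history]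
  | succ t ih =>
    rw [Finset.sum_range_succ]
    have hsum : ∑ k, 3 * √(pulls (history A r t) u k) +
        1 / √(max 1 (pulls (history A r t) u (play A r t u)) : ℕ) ≤
        ∑ k, 3 * √(pulls (history A r (t + 1)) u k) := by
      simp only [pulls_history_succ]
      rw [← Finset.add_sum_erase _ _ (Finset.mem_univ (play A r t u)),
        ← Finset.add_sum_erase (a := play A r t u) _
          (fun k => 3 * √((pulls (history A r t) u k + if play A r t u = k then 1 else 0 : ℕ) : ℝ))
          (Finset.mem_univ _)]
      have h1 := sqrt_succ_bound (pulls (history A r t) u (play A r t u))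
      have h2 : ∑ k ∈ Finset.univ.erase (play A r t u), 3 * √(pulls (history A r t) u k : ℝ) =
          ∑ k ∈ Finset.univ.erase (play A r t u), 3 * √((pulls (history A r t) u k +
            if play A r t u = k then 1 else 0 : ℕ) : ℝ) :=
        Finset.sum_congr rfl fun k hk => by
          rw [if_neg (Finset.ne_of_mem_erase hk).symm, add_zero]
      rw [h2]
      simp only [if_true]
      linarith
    have hrad : radius T (history A r t) u (play A r t u) =
        √(2 * Real.log T) * (1 / √(max 1 (pulls (history A r t) u (play A r t u)) : ℕ)) := by
      rw [radius, Real.sqrt_div' _ (Nat.cast_nonneg _), mul_one_div]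
    rw [hrad]
    calc _ ≤ √(2 * Real.log T) * (∑ k, 3 * √(pulls (history A r t) u k) +
        1 / √(max 1 (pulls (history A r t) u (play A r t u)) : ℕ)) := by
          rw [mul_add]; exact add_le_add_left ih _
      _ ≤ _ := mul_le_mul_of_nonneg_left hsum (Real.sqrt_nonneg _)

theorem sum_sqrt_pulls_le (A : Policy U K) (r : Rewards U K) (t : ℕ) (u : Fin U) :
    ∑ k, √(pulls (history A r t) u k) ≤ √(t * K) := by
  refine Real.le_sqrt_of_sq_le ((sq_sum_le_card_mul_sum_sq).trans (le_of_eq ?_))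
  simp only [Real.sq_sqrt (Nat.cast_nonneg _)]
  rw [← Nat.cast_sum, sum_pulls_history, Finset.card_univ, Fintype.card_fin, mul_comm]

theorem sum_radius_le_sqrt (A : Policy U K) (r : Rewards U K) (T : ℕ) (u : Fin U) :
    ∑ s ∈ Finset.range T, radius T (history A r s) u (play A r s u) ≤
      6 * √(T * K * Real.log T) := by
  refine (sum_radius_le A r T T u).trans ?_
  rw [← Finset.mul_sum, Real.sqrt_mul (by norm_num), Real.sqrt_mul (by positivity)]
  have h2 : √2 ≤ 2 := by
    rw [Real.sqrt_le_left (by norm_num)]; norm_num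
  calc √2 * √(Real.log T) * (3 * ∑ k, √(pulls (history A r T) u k))
      ≤ 2 * √(Real.log T) * (3 * √(T * K)) := by
        gcongr
        exact sum_sqrt_pulls_le A r T u
    _ = _ := by ring

theorem regret_mvm_le (hU : 0 < U) (hK : 0 < K) {σ : Equiv.Perm (Fin K)} {p : Fin U → Fin K}
    (hΘ : SPWithPeaks σ p I.Θ) :
    I.regret (mvm I.T I.B I.c σ p) ≤ 16 * (U * √(I.T * K * Real.log I.T)) := by
  set A := mvm I.T I.B I.c σ p with hAdef
  have hA : A.IsMeasurable := isMeasurable_mvm _ _ _ _ _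
  rw [regret_eq_integral_gap I hA]
  have hUT := I.users_le
  have hKT := I.arms_le
  rcases Nat.lt_or_ge I.T 2 with hT | hT
  · obtain rfl : K = 1 := by omega
    obtain ⟨π, -, hopt⟩ := I.exists_opt hK
    have : ∀ r t, play A r t = π := fun r t => Subsingleton.elim _ _
    simp only [this, hopt, sub_self, Finset.sum_const_zero, integral_zero]
    positivity
  have hT0 : (0 : ℝ) < I.T := by exact_mod_cast (by omega : 0 < I.T)
  set bad : ℕ → Set (Rewards U K) := fun t =>
    {r | ∃ u k, Deviates I.T (I.Θ u k) (history A r t) u k}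
  have hbad : ∀ t, MeasurableSet (bad t) := fun t => by
    have : bad t = ⋃ u, ⋃ k, {r | Deviates I.T (I.Θ u k) (history A r t) u k} := by
      ext r; simp [bad]
    rw [this]
    exact MeasurableSet.iUnion fun u => MeasurableSet.iUnion fun k =>
      measurableSet_deviates hA _ _ _ _ _
  have hgap : ∀ r t, I.opt - value I.Θ (play A r t) ≤
      ∑ u, 2 * radius I.T (history A r t) u (play A r t u) +
        (bad t).indicator (fun _ => (U : ℝ)) r := by
    intro r t
    have hrad : 0 ≤ ∑ u, 2 * radius I.T (history A r t) u (play A r t u) :=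
      Finset.sum_nonneg fun u _ => mul_nonneg (by norm_num) (Real.sqrt_nonneg _)
    by_cases hr : r ∈ bad t
    · rw [Set.indicator_of_mem hr]
      have := I.gap_le hK (play A r t)
      linarith
    · rw [Set.indicator_of_notMem hr, add_zero]
      refine gap_mvm_le I hU hK hΘ fun u k hd => hr ⟨u, k, hd⟩
  have hsum : ∀ r, ∑ t ∈ Finset.range I.T, (I.opt - value I.Θ (play A r t)) ≤
      U * (12 * √(I.T * K * Real.log I.T)) +
        ∑ t ∈ Finset.range I.T, (bad t).indicator (fun _ => (U : ℝ)) r := by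
    intro r
    refine (Finset.sum_le_sum fun t _ => hgap r t).trans ?_
    rw [Finset.sum_add_distrib, Finset.sum_comm]
    refine add_le_add_left ?_ _
    have : ∀ u ∈ Finset.univ, ∑ t ∈ Finset.range I.T,
        2 * radius I.T (history A r t) u (play A r t u) ≤ 12 * √(I.T * K * Real.log I.T) :=
      fun u _ => by
        rw [← Finset.mul_sum]
        linarith [sum_radius_le_sqrt A r I.T u]
    refine (Finset.sum_le_sum this).trans (le_of_eq ?_)
    simp
  have hindint : ∀ t, Integrable ((bad t).indicator fun _ => (U : ℝ)) I.rewardLaw := fun t =>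
    (integrable_const _).indicator (hbad t)
  have hlast : (1 : ℝ) ≤ 2 * √(I.T * K * Real.log I.T) := by
    have : 1 / 2 ≤ √(I.T * K * Real.log I.T) := by
      refine Real.le_sqrt_of_sq_le ?_
      have h1 := one_le_two_mul_log hT
      have hK1 : (1 : ℝ) ≤ K := by exact_mod_cast hK
      have hT1 : (1 : ℝ) ≤ I.T := by exact_mod_cast (by omega : 1 ≤ I.T)
      have h2 : (1 : ℝ) ≤ I.T * K := one_le_mul_of_one_le_of_one_le hT1 hK1
      nlinarith
    linarith
  calc ∫ r, ∑ t ∈ Finset.range I.T, (I.opt - value I.Θ (play A r t)) ∂I.rewardLaw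
      ≤ ∫ r, (U * (12 * √(I.T * K * Real.log I.T)) +
        ∑ t ∈ Finset.range I.T, (bad t).indicator (fun _ => (U : ℝ)) r) ∂I.rewardLaw :=
        integral_mono (integrable_finsetSum _ fun t _ =>
          integrable_play I hA (fun π => I.opt - value I.Θ π) t)
          ((integrable_const _).add (integrable_finsetSum _ fun t _ => hindint t)) hsum
    _ = U * (12 * √(I.T * K * Real.log I.T)) +
        ∑ t ∈ Finset.range I.T, I.rewardLaw.real (bad t) * U := by
        rw [integral_add (integrable_const _) (integrable_finsetSum _ fun t _ => hindint t),
          integral_finsetSum _ fun t _ => hindint t]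
        simp [integral_indicator_const, hbad]
    _ ≤ U * (12 * √(I.T * K * Real.log I.T)) + ∑ t ∈ Finset.range I.T, 2 / I.T * (U : ℝ) := by
        gcongr with t ht
        exact measure_exists_deviates_le I hA hT hUT hKT (Finset.mem_range.1 ht).le
    _ = U * (12 * √(I.T * K * Real.log I.T)) + 2 * U := by
        simp only [Finset.sum_const, Finset.card_range, nsmul_eq_mul]
        field_simp
    _ ≤ _ := by
        have hU0 : (0 : ℝ) ≤ U := Nat.cast_nonneg _
        nlinarith

end Gap

/-! ### Reasoning about programs -/

@[simp] theorem Memory.setNat_nat (m : Memory) (a i j v a' i' j' : ℕ) :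
    (m.setNat a i j v).nat a' i' j' =
      if a' = a ∧ i' = i ∧ j' = j then v else m.nat a' i' j' := rfl

@[simp] theorem Memory.setNat_real (m : Memory) (a i j v : ℕ) :
    (m.setNat a i j v).real = m.real := rfl

@[simp] theorem Memory.setReal_real (m : Memory) (a i j : ℕ) (v : ℝ) (a' i' j' : ℕ) :
    (m.setReal a i j v).real a' i' j' =
      if a' = a ∧ i' = i ∧ j' = j then v else m.real a' i' j' := rfl

@[simp] theorem Memory.setReal_nat (m : Memory) (a i j : ℕ) (v : ℝ) :
    (m.setReal a i j v).nat = m.nat := rfl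

theorem Memory.setNat_nat_ne (m : Memory) {a a' : ℕ} (h : a' ≠ a) (i j v : ℕ) :
    (m.setNat a i j v).nat a' = m.nat a' := by
  ext; simp [h]

theorem Memory.setReal_real_ne (m : Memory) {a a' : ℕ} (h : a' ≠ a) (i j : ℕ) (v : ℝ) :
    (m.setReal a i j v).real a' = m.real a' := by
  ext; simp [h]

namespace Program

/-- The memory after running a program. -/
noncomputable def exec (P : Program) (m : Memory) : Memory := (P.run m).1

@[simp] theorem exec_skip (m : Memory) : skip.exec m = m := rfl

@[simp] theorem exec_setNat (a : ℕ) (i j e : NExp) (m : Memory) :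
    (setNat a i j e).exec m = m.setNat a (i.eval m) (j.eval m) (e.eval m) := rfl

@[simp] theorem exec_setReal (a : ℕ) (i j : NExp) (e : RExp) (m : Memory) :
    (setReal a i j e).exec m = m.setReal a (i.eval m) (j.eval m) (e.eval m) := rfl

@[simp] theorem exec_seq (P Q : Program) (m : Memory) :
    (seq P Q).exec m = Q.exec (P.exec m) := rfl

open Classical in
@[simp] theorem exec_ite (b : Test) (P Q : Program) (m : Memory) :
    (ite b P Q).exec m = if b.holds m then P.exec m else Q.exec m := by
  simp only [exec, run]
  split_ifs <;> rfl

/-- The arrays of natural cells that a program may write. -/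
def natWrites : Program → List ℕ
  | skip => []
  | setNat a _ _ _ => [a]
  | setReal _ _ _ _ => []
  | seq P Q => P.natWrites ++ Q.natWrites
  | ite _ P Q => P.natWrites ++ Q.natWrites
  | loop x _ body => x :: body.natWrites

/-- The arrays of real cells that a program may write. -/
def realWrites : Program → List ℕ
  | skip => []
  | setNat _ _ _ _ => []
  | setReal a _ _ _ => [a]
  | seq P Q => P.realWrites ++ Q.realWrites
  | ite _ P Q => P.realWrites ++ Q.realWrites
  | loop _ _ body => body.realWrites

/-- `m` and `m'` agree on the arrays that `P` does not write. -/
structure Agree (P : Program) (m m' : Memory) : Prop where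
  nat : ∀ a, a ∉ P.natWrites → m'.nat a = m.nat a
  real : ∀ a, a ∉ P.realWrites → m'.real a = m.real a

theorem Agree.refl (P : Program) (m : Memory) : P.Agree m m :=
  ⟨fun _ _ => rfl, fun _ _ => rfl⟩

theorem Agree.trans {P : Program} {m₁ m₂ m₃ : Memory} (h : P.Agree m₁ m₂) (h' : P.Agree m₂ m₃) :
    P.Agree m₁ m₃ :=
  ⟨fun a ha => (h'.nat a ha).trans (h.nat a ha), fun a ha => (h'.real a ha).trans (h.real a ha)⟩

theorem Agree.mono {P Q : Program} {m m' : Memory} (h : P.Agree m m')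
    (hn : ∀ a ∈ P.natWrites, a ∈ Q.natWrites) (hr : ∀ a ∈ P.realWrites, a ∈ Q.realWrites) :
    Q.Agree m m' :=
  ⟨fun a ha => h.nat a fun h' => ha (hn a h'), fun a ha => h.real a fun h' => ha (hr a h')⟩

/-- The memory after `n` iterations of a loop. -/
noncomputable def iterate (x : ℕ) (body : Program) (m : Memory) : ℕ → Memory
  | 0 => m
  | n + 1 => body.exec ((iterate x body m n).setNat x 0 0 n)

theorem exec_loop (x : ℕ) (e : NExp) (body : Program) (m : Memory) :
    (loop x e body).exec m = iterate x body m (e.eval m) := by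
  rw [exec, run]
  induction e.eval m with
  | zero => rfl
  | succ n ih => rw [List.range_succ, List.foldl_append, List.foldl_cons, List.foldl_nil, ih]; rfl

theorem agree_setNat {P : Program} {a : ℕ} (ha : a ∈ P.natWrites) (m : Memory) (i j v : ℕ) :
    P.Agree m (m.setNat a i j v) :=
  ⟨fun b hb => m.setNat_nat_ne (fun h : b = a => hb (h ▸ ha)) i j v, fun _ _ => rfl⟩

theorem agree_exec (P : Program) (m : Memory) : P.Agree m (P.exec m) := by
  induction P generalizing m with
  | skip => exact Agree.refl _ _
  | setNat a i j e => exact agree_setNat (by simp [natWrites]) m _ _ _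
  | setReal a i j e =>
    exact ⟨fun _ _ => rfl, fun b hb => m.setReal_real_ne (by simpa [realWrites] using hb) _ _ _⟩
  | seq P Q hP hQ =>
    exact ((hP m).mono (by simp +contextual [natWrites]) (by simp +contextual [realWrites])).trans
      ((hQ _).mono (by simp +contextual [natWrites]) (by simp +contextual [realWrites]))
  | ite b P Q hP hQ =>
    rw [exec_ite]
    split_ifs
    · exact (hP m).mono (by simp +contextual [natWrites]) (by simp +contextual [realWrites])
    · exact (hQ m).mono (by simp +contextual [natWrites]) (by simp +contextual [realWrites])
  | loop x e body ih =>
    rw [exec_loop]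
    induction e.eval m with
    | zero => exact Agree.refl _ _
    | succ n hn =>
      exact (hn.trans (agree_setNat (by simp [natWrites]) _ _ _ _)).trans
        ((ih _).mono (by simp +contextual [natWrites]) (by simp [realWrites]))

theorem exec_nat_of_notMem {P : Program} {a : ℕ} (m : Memory) (h : a ∉ P.natWrites) :
    (P.exec m).nat a = m.nat a := (P.agree_exec m).nat a h

theorem exec_real_of_notMem {P : Program} {a : ℕ} (m : Memory) (h : a ∉ P.realWrites) :
    (P.exec m).real a = m.real a := (P.agree_exec m).real a h

/-- The invariant rule for loops. -/
theorem loop_rule {x : ℕ} {e : NExp} {body : Program} {m : Memory} {N : ℕ} (hN : e.eval m = N)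
    (Inv : ℕ → Memory → Prop) (h0 : Inv 0 m)
    (hctr : ∀ i m' v, Inv i m' → Inv i (m'.setNat x 0 0 v))
    (hstep : ∀ i m', i < N → (loop x e body).Agree m m' → m'.nat x 0 0 = i → Inv i m' →
      Inv (i + 1) (body.exec m')) :
    Inv N ((loop x e body).exec m) := by
  rw [exec_loop, hN]
  suffices h : ∀ n ≤ N, (loop x e body).Agree m (iterate x body m n) ∧
      Inv n (iterate x body m n) from (h N le_rfl).2
  intro n
  induction n with
  | zero => exact fun _ => ⟨Agree.refl _ _, h0⟩
  | succ n ih =>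
    intro hn
    obtain ⟨h1, h2⟩ := ih (by omega)
    have h3 := h1.trans (agree_setNat (P := loop x e body) (a := x) (by simp [natWrites])
      (iterate x body m n) 0 0 n)
    exact ⟨h3.trans ((agree_exec body _).mono (by simp +contextual [natWrites])
      (by simp [realWrites])), hstep n _ (by omega) h3 (by simp) (hctr _ _ _ h2)⟩

/-- The rule for two nested loops that establish the property `Q i j` in iteration `(i, j)`. -/
theorem grid_rule {x y : ℕ} {e f : NExp} {body : Program} {m : Memory} {N M : ℕ}
    (hN : e.eval m = N)
    (hM : ∀ m', (loop x e (loop y f body)).Agree m m' → f.eval m' = M)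
    (hx : x ∉ (loop y f body).natWrites)
    (Q : ℕ → ℕ → Memory → Prop)
    (hQx : ∀ i j m' v, Q i j m' → Q i j (m'.setNat x 0 0 v))
    (hQy : ∀ i j m' v, Q i j m' → Q i j (m'.setNat y 0 0 v))
    (hstep : ∀ i j m', i < N → j < M → (loop x e (loop y f body)).Agree m m' →
      m'.nat x 0 0 = i → m'.nat y 0 0 = j →
      (∀ i' j', j' < M → (i' < i ∨ i' = i ∧ j' < j) → Q i' j' m') →
      ∀ i' j', j' < M → (i' < i ∨ i' = i ∧ j' < j + 1) → Q i' j' (body.exec m')) :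
    ∀ i < N, ∀ j < M, Q i j ((loop x e (loop y f body)).exec m) := by
  refine loop_rule (x := x) (body := loop y f body) hN
    (fun i m' => ∀ i' < i, ∀ j < M, Q i' j m') (by simp)
    (fun i m' v h i' hi' j hj => hQx _ _ _ _ (h i' hi' j hj)) ?_
  intro i m' hi hag hxi hinv
  have hwrites : ∀ {m''}, (loop y f body).Agree m' m'' → (loop x e (loop y f body)).Agree m m'' :=
    fun h => hag.trans (h.mono (by simp +contextual [natWrites]) (by simp [realWrites]))
  have hin := loop_rule (x := y) (body := body) (hM m' hag)
    (fun j m'' => ∀ i' j', j' < M → (i' < i ∨ i' = i ∧ j' < j) → Q i' j' m'')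
    (fun i' j' hj' h => hinv i' (by omega) j' hj')
    (fun j m'' v h i' j' hj' h' => hQy _ _ _ _ (h i' j' hj' h'))
    (fun j m'' hj hag' hy h => hstep i j m'' hi hj (hwrites hag')
      ((congrFun₂ (hag'.nat x hx) 0 0).trans hxi) hy h)
  exact fun i' hi' j hj => hin i' j hj (by omega)

/-! ### Running times -/

end Program

/-- The expression reads only the natural array `0`. -/
def NExp.headerOnly : NExp → Bool
  | lit _ => true
  | get a i j => a == 0 && i.headerOnly && j.headerOnly
  | add e f => e.headerOnly && f.headerOnly
  | sub e f => e.headerOnly && f.headerOnly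

theorem NExp.eval_congr_of_headerOnly {e : NExp} (h : e.headerOnly = true) {m m' : Memory}
    (hm : m.nat 0 = m'.nat 0) : e.eval m = e.eval m' := by
  induction e with
  | lit n => rfl
  | get a i j hi hj =>
    simp only [headerOnly, Bool.and_eq_true, beq_iff_eq] at h
    simp only [eval, hi h.1.2, hj h.2, h.1.1, hm]
  | add e f he hf =>
    simp only [headerOnly, Bool.and_eq_true] at h
    simp only [eval, he h.1, hf h.2]
  | sub e f he hf =>
    simp only [headerOnly, Bool.and_eq_true] at h
    simp only [eval, he h.1, hf h.2]

namespace Program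

/-- All loop bounds are computed from the natural array `0`. -/
def headerLoops : Program → Bool
  | seq P Q => P.headerLoops && Q.headerLoops
  | ite _ P Q => P.headerLoops && Q.headerLoops
  | loop _ e body => e.headerOnly && body.headerLoops
  | _ => true

/-- A bound on the number of steps if the loop bounds are evaluated in the memory `m`. -/
def stepBound (m : Memory) : Program → ℕ
  | skip => 1
  | setNat _ i j e => i.cost + j.cost + e.cost + 1
  | setReal _ i j e => i.cost + j.cost + e.cost + 1
  | seq P Q => P.stepBound m + Q.stepBound m
  | ite b P Q => b.cost + P.stepBound m + Q.stepBound m + 1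
  | loop _ e body => e.cost + 1 + e.eval m * (body.stepBound m + 1)

theorem steps_le_stepBound {P : Program} (hP : P.headerLoops = true) (h0 : 0 ∉ P.natWrites)
    {m m' : Memory} (hm : m'.nat 0 = m.nat 0) : (P.run m').2 ≤ P.stepBound m := by
  induction P generalizing m' with
  | skip => exact le_rfl
  | setNat a i j e => exact le_rfl
  | setReal a i j e => exact le_rfl
  | seq P Q ihP ihQ =>
    simp only [headerLoops, Bool.and_eq_true, natWrites, List.mem_append, not_or] at hP h0
    exact add_le_add (ihP hP.1 h0.1 hm)
      (ihQ hP.2 h0.2 ((exec_nat_of_notMem m' h0.1).trans hm))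
  | ite b P Q ihP ihQ =>
    simp only [headerLoops, Bool.and_eq_true, natWrites, List.mem_append, not_or] at hP h0
    have h1 := ihP hP.1 h0.1 hm
    have h2 := ihQ hP.2 h0.2 hm
    simp only [run, stepBound]
    split_ifs <;> simp only <;> omega
  | loop x e body ih =>
    simp only [headerLoops, Bool.and_eq_true, natWrites, List.mem_cons, not_or] at hP h0
    simp only [run, stepBound, NExp.eval_congr_of_headerOnly hP.1 hm]
    suffices h : ∀ n, ((List.range n).foldl (fun s i =>
        ((body.run (s.1.setNat x 0 0 i)).1, s.2 + (body.run (s.1.setNat x 0 0 i)).2 + 1))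
        (m', e.cost + 1)).1.nat 0 = m.nat 0 ∧ ((List.range n).foldl (fun s i =>
        ((body.run (s.1.setNat x 0 0 i)).1, s.2 + (body.run (s.1.setNat x 0 0 i)).2 + 1))
        (m', e.cost + 1)).2 ≤ e.cost + 1 + n * (body.stepBound m + 1) from (h _).2
    intro n
    induction n with
    | zero => simpa using hm
    | succ n hn =>
      rw [List.range_succ, List.foldl_append, List.foldl_cons, List.foldl_nil]
      set s := (List.range n).foldl (fun s i =>
        ((body.run (s.1.setNat x 0 0 i)).1, s.2 + (body.run (s.1.setNat x 0 0 i)).2 + 1))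
        (m', e.cost + 1)
      have hs : (s.1.setNat x 0 0 n).nat 0 = m.nat 0 :=
        (s.1.setNat_nat_ne h0.1 0 0 n).trans hn.1
      refine ⟨(exec_nat_of_notMem _ h0.2).trans hs, ?_⟩
      have h1 := ih hP.2 h0.2 hs
      have h2 := hn.2
      simp only
      rw [Nat.add_mul, one_mul]
      omega

end Program

/-! ### The machine of Match-via-Maximal

Natural arrays: `4` the matching, `5` the numbers of pulls, `6` the numbers of the peaks, `7` the
costs by number, `8` the table of second rightmost arms, `9` an auxiliary cell, `10`, `11`, `12`
counters, `13` the flags of the selected arms, `14` and `15` the current arm and budget, `16` the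
numbers of the arms. Real arrays: `1` the sums of rewards, `2` the maximal matrix by number, `3`
the matrix `G`, `4` the table `F`, `5` and `6` auxiliary cells. -/

namespace Machine

open Program

abbrev cell (a : ℕ) : NExp := .get a (.lit 0) (.lit 0)

abbrev entry (a : ℕ) (i : NExp) : NExp := .get a i (.lit 0)

abbrev realCell (a : ℕ) : RExp := .get a (.lit 0) (.lit 0)

abbrev setCell (a : ℕ) (e : NExp) : Program := .setNat a (.lit 0) (.lit 0) e

abbrev setRealCell (a : ℕ) (e : RExp) : Program := .setReal a (.lit 0) (.lit 0) e

abbrev usersExp : NExp := .get 0 (.lit 0) (.lit 0)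
abbrev armsExp : NExp := .get 0 (.lit 1) (.lit 0)
abbrev budgetExp : NExp := .get 0 (.lit 2) (.lit 0)
abbrev horizonExp : NExp := .get 0 (.lit 3) (.lit 0)

/-- The upper confidence bound of user `u` for the arm at position `j`. -/
def ucbExp (u j : NExp) : RExp :=
  .add (.div (.get 1 u (entry 2 j)) (.ofNat (.get 5 u (entry 2 j))))
    (.sqrt (.div (.mul (.ofNat (.lit 2)) (.log (.ofNat horizonExp)))
      (.ofNat (.add (.lit 1) (.sub (.get 5 u (entry 2 j)) (.lit 1))))))

def costsProg : Program :=
  .seq (setCell 7 (.lit 0))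
    (.loop 10 armsExp (.setNat 7 (.add (cell 10) (.lit 1)) (.lit 0) (entry 1 (entry 2 (cell 10)))))

def numbersProg : Program :=
  .loop 10 armsExp (.setNat 16 (entry 2 (cell 10)) (.lit 0) (.add (cell 10) (.lit 1)))

def peaksProg : Program :=
  .loop 10 usersExp (.setNat 6 (cell 10) (.lit 0) (entry 16 (entry 3 (cell 10))))

def minProg : Program :=
  .seq (setRealCell 6 (ucbExp (cell 10) (.sub (cell 11) (.lit 1))))
    (.loop 12 armsExp
      (.ite (.natLe
        (.add
          (.sub (.sub (cell 11) (.sub (cell 11) (entry 6 (cell 10)))) (.add (cell 12) (.lit 1)))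
          (.sub (.add (cell 12) (.lit 1)) (.add (cell 11) (.sub (entry 6 (cell 10)) (cell 11)))))
        (.lit 0))
        (.ite (.realLe (ucbExp (cell 10) (cell 12)) (realCell 6))
          (setRealCell 6 (ucbExp (cell 10) (cell 12))) .skip)
        .skip))

def maximalProg : Program :=
  .loop 10 usersExp (.loop 11 (.add armsExp (.lit 1))
    (.seq (.ite (.natLe (.lit 1) (cell 11)) minProg (setRealCell 6 (.ofNat (.lit 0))))
      (.setReal 2 (cell 10) (cell 11) (realCell 6))))

def gainProg : Program :=
  .seq (setRealCell 5 (.ofNat (.lit 0)))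
    (.loop 12 usersExp
      (.ite (.natLe
        (.add (.sub (.add (cell 10) (.lit 1)) (entry 6 (cell 12)))
          (.sub (entry 6 (cell 12)) (cell 11))) (.lit 0))
        (.ite (.realLe (.get 2 (cell 12) (cell 10)) (.get 2 (cell 12) (cell 11)))
          (setRealCell 5 (.add (realCell 5) (.get 2 (cell 12) (cell 11))))
          (setRealCell 5 (.add (realCell 5) (.get 2 (cell 12) (cell 10)))))
        .skip))

def gainsProg : Program :=
  .loop 10 (.add armsExp (.lit 1)) (.loop 11 (.add armsExp (.lit 1))
    (.seq gainProg (.setReal 3 (cell 10) (cell 11) (realCell 5))))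

/-- The value of the candidate `i` for the table entry at the counters `10` and `11`. -/
def candidateExp (i : NExp) : RExp :=
  .add (.get 4 i (.sub (cell 11) (entry 7 (cell 10)))) (.get 3 i (cell 10))

def entryProg : Program :=
  .seq (setCell 9 (.lit 0)) (.seq (setRealCell 6 (candidateExp (.lit 0)))
    (.loop 12 armsExp
      (.ite (.natLe (.add (.sub (.add (cell 12) (.lit 1)) (cell 10))
          (.sub (.add (entry 7 (cell 12)) (entry 7 (cell 10))) (cell 11))) (.lit 0))
        (.ite (.realLe (candidateExp (cell 12)) (realCell 6)) .skip
          (.seq (setCell 9 (cell 12)) (setRealCell 6 (candidateExp (cell 12)))))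
        .skip)))

def tableProg : Program :=
  .loop 10 (.add armsExp (.lit 1)) (.loop 11 (.add budgetExp (.lit 1))
    (.seq (.ite (.natLe (.lit 1) (cell 10)) entryProg (setRealCell 6 (.ofNat (.lit 0))))
      (.seq (.setReal 4 (cell 10) (cell 11) (realCell 6))
        (.setNat 8 (cell 10) (cell 11) (cell 9)))))

def restProg : Program :=
  .seq (setRealCell 5 (.ofNat (.lit 0)))
    (.loop 12 usersExp
      (.ite (.natLe (.add (cell 10) (.lit 2)) (entry 6 (cell 12)))
        (setRealCell 5 (.add (realCell 5) (.get 2 (cell 12) (.add (cell 10) (.lit 1)))))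
        .skip))

def lastUpdate : Program :=
  .seq (setCell 14 (.add (cell 10) (.lit 1))) (setRealCell 6 (realCell 5))

def lastProg : Program :=
  .seq (setCell 14 (.lit 0))
    (.loop 10 armsExp
      (.seq restProg
        (.seq (setRealCell 5 (.add (.get 4 (.add (cell 10) (.lit 1)) budgetExp) (realCell 5)))
          (.ite (.natLe (.lit 1) (cell 14))
            (.ite (.realLe (realCell 5) (realCell 6)) .skip lastUpdate)
            lastUpdate))))

def clearProg : Program :=
  .seq (.loop 10 (.add armsExp (.lit 1)) (.setNat 13 (cell 10) (.lit 0) (.lit 0)))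
    (setCell 15 budgetExp)

def backtrackProg : Program :=
  .loop 10 armsExp
    (.ite (.natLe (.lit 1) (cell 14))
      (.seq (.setNat 13 (cell 14) (.lit 0) (.lit 1))
        (.seq (setCell 9 (.get 8 (cell 14) (cell 15)))
          (.seq (setCell 15 (.sub (cell 15) (entry 7 (cell 14))))
            (setCell 14 (cell 9)))))
      .skip)

def bestProg : Program :=
  .seq (setCell 9 (.lit 0))
    (.loop 11 (.add armsExp (.lit 1))
      (.ite (.natLe (.lit 1) (entry 13 (cell 11)))
        (.ite (.natLe (.lit 1) (cell 9))
          (.ite (.realLe (.get 2 (cell 10) (cell 11)) (.get 2 (cell 10) (cell 9))) .skip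
            (setCell 9 (cell 11)))
          (setCell 9 (cell 11)))
        .skip))

def outputProg : Program :=
  .loop 10 usersExp
    (.seq bestProg (.setNat 4 (cell 10) (.lit 0) (entry 2 (.sub (cell 9) (.lit 1)))))

/-- The program that selects the matching. -/
def choose : Program :=
  .seq costsProg (.seq numbersProg (.seq peaksProg (.seq maximalProg (.seq gainsProg
    (.seq tableProg (.seq lastProg (.seq clearProg (.seq backtrackProg outputProg))))))))

/-- The program that processes the observed rewards. -/
def learn : Program :=
  .loop 10 usersExp
    (.seq
      (.setReal 1 (cell 10) (entry 4 (cell 10))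
        (.add (.get 1 (cell 10) (entry 4 (cell 10))) (.get 0 (cell 10) (.lit 0))))
      (.setNat 5 (cell 10) (entry 4 (cell 10))
        (.add (.get 5 (cell 10) (entry 4 (cell 10))) (.lit 1))))

theorem stepBound_choose_add_learn_le {U K B : ℕ} (hU : 0 < U) (hK : 0 < K) {m : Memory}
    (h0 : m.nat 0 0 0 = U) (h1 : m.nat 0 1 0 = K) (h2 : m.nat 0 2 0 = B) :
    choose.stepBound m + learn.stepBound m ≤ 10000 * (K ^ 2 * U + K ^ 2 * B) := by
  have e1 : K * U ≤ K ^ 2 * U := Nat.mul_le_mul_right U (by nlinarith)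
  have e2 : U ≤ K * U := Nat.le_mul_of_pos_left U hK
  have e3 : K ^ 2 ≤ K ^ 2 * U := Nat.le_mul_of_pos_right _ hU
  have e4 : K ≤ K ^ 2 := by nlinarith
  have e5 : K * B ≤ K ^ 2 * B := Nat.mul_le_mul_right B e4
  have e6 : B ≤ K * B := Nat.le_mul_of_pos_left B hK
  simp only [choose, learn, costsProg, numbersProg, peaksProg, maximalProg, minProg, gainProg,
    gainsProg, entryProg, candidateExp, tableProg, restProg, lastUpdate, lastProg, clearProg,
    backtrackProg, bestProg, outputProg, ucbExp, Program.stepBound, NExp.eval, NExp.cost,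
    RExp.cost, Test.cost, h0, h1, h2]
  ring_nf
  nlinarith


/-- The persistent part of the memory: the instance and the statistics of the history `h`. -/
structure Holds (T B : ℕ) (c : Fin K → ℕ) (σ : Equiv.Perm (Fin K)) (p : Fin U → Fin K)
    (h : List (Obs U K)) (m : Memory) : Prop where
  users : m.nat 0 0 0 = U
  arms : m.nat 0 1 0 = K
  budget : m.nat 0 2 0 = B
  horizon : m.nat 0 3 0 = T
  costs : ∀ k : Fin K, m.nat 1 k 0 = c k
  order : ∀ j : Fin K, m.nat 2 j 0 = σ j
  peaks : ∀ u : Fin U, m.nat 3 u 0 = p u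
  pulls : ∀ (u : Fin U) (k : Fin K), m.nat 5 u k = pulls h u k
  sums : ∀ (u : Fin U) (k : Fin K), m.real 1 u k = obsSum h u k

section

variable {T B : ℕ} {c : Fin K → ℕ} {σ : Equiv.Perm (Fin K)} {p : Fin U → Fin K}
  {h : List (Obs U K)} {m : Memory}

theorem Holds.of_agree (hm : Holds T B c σ p h m) {P : Program} {m' : Memory}
    (hag : P.Agree m m') (hn : ∀ a ∈ [0, 1, 2, 3, 5], a ∉ P.natWrites)
    (hr : 1 ∉ P.realWrites) : Holds T B c σ p h m' := by
  simp only [List.forall_mem_cons] at hn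
  obtain ⟨n0, n1, n2, n3, n5, -⟩ := hn
  constructor
  · rw [hag.nat 0 n0]; exact hm.users
  · rw [hag.nat 0 n0]; exact hm.arms
  · rw [hag.nat 0 n0]; exact hm.budget
  · rw [hag.nat 0 n0]; exact hm.horizon
  · rw [hag.nat 1 n1]; exact hm.costs
  · rw [hag.nat 2 n2]; exact hm.order
  · rw [hag.nat 3 n3]; exact hm.peaks
  · rw [hag.nat 5 n5]; exact hm.pulls
  · rw [hag.real 1 hr]; exact hm.sums

theorem Holds.exec (hm : Holds T B c σ p h m) {P : Program}
    (hn : ∀ a ∈ [0, 1, 2, 3, 5], a ∉ P.natWrites) (hr : 1 ∉ P.realWrites) :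
    Holds T B c σ p h (P.exec m) :=
  hm.of_agree (P.agree_exec m) hn hr

theorem exec_costsProg (hm : Holds T B c σ p h m) :
    ∀ j ≤ K, (costsProg.exec m).nat 7 j 0 = pad (fun j => c (σ j)) j := by
  have hm1 := hm.exec (P := setCell 7 (.lit 0)) (by decide) (by decide)
  rw [costsProg, exec_seq]
  refine loop_rule (e := armsExp) (N := K) hm1.arms
    (fun i m' => ∀ j ≤ i, m'.nat 7 j 0 = pad (fun j => c (σ j)) j) ?_ ?_ ?_
  · intro j hj
    obtain rfl : j = 0 := by omega
    simp [NExp.eval]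
  · intro i m' v hI j hj
    simpa using hI j hj
  · intro i m' hi hag hx hI j hj
    have hm' := hm1.of_agree hag (by decide) (by decide)
    have h2 := hm'.order ⟨i, hi⟩
    have h1 := hm'.costs (σ ⟨i, hi⟩)
    simp only at h2
    simp only [exec_setNat, NExp.eval, hx, h2, h1, Memory.setNat_nat]
    by_cases hji : j = i + 1
    · subst hji
      simp [pad, hi]
    · simpa [hji] using hI j (by omega)

theorem exec_numbersProg (hm : Holds T B c σ p h m) (j : Fin K) :
    (numbersProg.exec m).nat 16 (σ j) 0 = j + 1 := by
  refine loop_rule (e := armsExp) (N := K) hm.arms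
    (fun i m' => ∀ j : Fin K, (j : ℕ) < i → m'.nat 16 (σ j) 0 = j + 1) ?_ ?_ ?_ j j.2
  · intro j hj
    omega
  · intro i m' v hI j hj
    simpa using hI j hj
  · intro i m' hi hag hx hI j hj
    have hm' := hm.of_agree hag (by decide) (by decide)
    have h2 := hm'.order ⟨i, hi⟩
    simp only at h2
    simp only [exec_setNat, NExp.eval, hx, h2, Memory.setNat_nat]
    by_cases hji : j = ⟨i, hi⟩
    · subst hji
      simp
    · have : (σ j : ℕ) ≠ σ ⟨i, hi⟩ := fun he => hji (σ.injective (Fin.ext he))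
      have hne : (j : ℕ) ≠ i := fun he => hji (Fin.ext he)
      simpa [this] using hI j (by omega)

theorem exec_peaksProg (hm : Holds T B c σ p h m)
    (hnum : ∀ j : Fin K, m.nat 16 (σ j) 0 = j + 1) (u : Fin U) :
    (peaksProg.exec m).nat 6 u 0 = (σ.symm (p u) : ℕ) + 1 := by
  refine loop_rule (e := usersExp) (N := U) hm.users
    (fun i m' => ∀ u : Fin U, (u : ℕ) < i → m'.nat 6 u 0 = (σ.symm (p u) : ℕ) + 1)
    ?_ ?_ ?_ u u.2
  · intro u hu
    omega
  · intro i m' v hI j hj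
    simpa using hI j hj
  · intro i m' hi hag hx hI u hu
    have hm' := hm.of_agree hag (by decide) (by decide)
    have h3 := hm'.peaks ⟨i, hi⟩
    have h16 := hnum (σ.symm (p ⟨i, hi⟩))
    rw [← hag.nat 16 (by decide), Equiv.apply_symm_apply] at h16
    simp only at h3
    simp only [exec_setNat, NExp.eval, hx, h3, h16, Memory.setNat_nat]
    by_cases hui : (u : ℕ) = i
    · obtain rfl : u = ⟨i, hi⟩ := Fin.ext hui
      simp
    · simpa [hui] using hI u (by omega)

theorem eval_ucbExp (hm : Holds T B c σ p h m) {u j : NExp} {v : Fin U} {l : Fin K}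
    (hu : u.eval m = v) (hj : j.eval m = l) : (ucbExp u j).eval m = ucb T h v (σ l) := by
  have hmax : ∀ n : ℕ, 1 + (n - 1) = max 1 n := fun n => by omega
  simp only [ucbExp, RExp.eval, NExp.eval, hu, hj, hm.order, hm.sums, hm.pulls, hm.horizon, hmax,
    ucb, empMean_eq, radius]
  norm_num

theorem exec_minProg (hm : Holds T B c σ p h m)
    (hpk : ∀ u : Fin U, m.nat 6 u 0 = (σ.symm (p u) : ℕ) + 1) (u : Fin U) (k : Fin K)
    (hu : m.nat 10 0 0 = u) (hk : m.nat 11 0 0 = k + 1) :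
    (minProg.exec m).real 6 0 0 = maximalMatrix T σ p h u (σ k) := by
  set P₁ : Program := setRealCell 6 (ucbExp (cell 10) (.sub (cell 11) (.lit 1))) with hP₁
  have hm1 := hm.exec (P := P₁) (by decide) (by decide)
  rw [minProg, exec_seq]
  set S := Finset.uIcc k (σ.symm (p u)) with hS
  suffices hfin : (∀ l : Fin K, l ∈ S → (l : ℕ) < K → ((loop 12 armsExp _).exec
      (P₁.exec m)).real 6 0 0 ≤ ucb T h u (σ l)) ∧ ∃ l ∈ S, ((loop 12 armsExp _).exec
      (P₁.exec m)).real 6 0 0 = ucb T h u (σ l) by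
    obtain ⟨h1, l, hl, h2⟩ := hfin
    simp only [maximalMatrix, Equiv.symm_apply_apply]
    refine le_antisymm (Finset.le_inf' _ _ fun l' hl' => h1 l' hl' l'.2) ?_
    refine le_of_le_of_eq (Finset.inf'_le _ hl) h2.symm
  refine loop_rule (e := armsExp) (N := K) hm1.arms
    (fun i m' => (∀ l : Fin K, l ∈ S → (l : ℕ) < i → m'.real 6 0 0 ≤ ucb T h u (σ l)) ∧
      ∃ l ∈ S, m'.real 6 0 0 = ucb T h u (σ l)) ?_ ?_ ?_
  · refine ⟨fun l _ hl => by omega, k, Finset.left_mem_uIcc, ?_⟩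
    simp only [hP₁, exec_setReal, NExp.eval, Memory.setReal_real, and_self, if_true]
    exact eval_ucbExp hm hu (by simp [NExp.eval, hk])
  · intro i m' v hI
    simpa using hI
  · intro i m' hi hag hx ⟨hle, l₀, hl₀, heq⟩
    have hm' := hm1.of_agree hag (by decide) (by decide)
    have h10 : m'.nat 10 0 0 = u := by
      rw [hag.nat 10 (by decide), exec_nat_of_notMem m (by decide), hu]
    have h11 : m'.nat 11 0 0 = k + 1 := by
      rw [hag.nat 11 (by decide), exec_nat_of_notMem m (by decide), hk]
    have h6 : m'.nat 6 u 0 = (σ.symm (p u) : ℕ) + 1 := by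
      rw [hag.nat 6 (by decide), exec_nat_of_notMem m (by decide), hpk]
    have hucb : (ucbExp (cell 10) (cell 12)).eval m' = ucb T h u (σ ⟨i, hi⟩) :=
      eval_ucbExp hm' (by simp [NExp.eval, h10]) (by simp [NExp.eval, hx])
    have htest : (Test.natLe (.add
          (.sub (.sub (cell 11) (.sub (cell 11) (entry 6 (cell 10)))) (.add (cell 12) (.lit 1)))
          (.sub (.add (cell 12) (.lit 1)) (.add (cell 11) (.sub (entry 6 (cell 10)) (cell 11)))))
        (.lit 0)).holds m' ↔ (⟨i, hi⟩ : Fin K) ∈ S := by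
      simp only [Test.holds, NExp.eval, h10, h11, hx, h6, hS, Finset.mem_uIcc', Fin.le_def]
      omega
    have hlt : ∀ l : Fin K, (l : ℕ) < i + 1 → (l : ℕ) < i ∨ l = ⟨i, hi⟩ := fun l hl => by
      rcases Nat.lt_succ_iff_lt_or_eq.1 hl with h | h
      · exact Or.inl h
      · exact Or.inr (Fin.ext h)
    rw [exec_ite]
    split_ifs with hin
    · rw [htest] at hin
      rw [exec_ite]
      split_ifs with hmin
      · simp only [Test.holds, hucb, RExp.eval, NExp.eval] at hmin
        simp only [exec_setReal, NExp.eval, Memory.setReal_real, and_self, if_true, hucb]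
        refine ⟨fun l hl hli => ?_, _, hin, rfl⟩
        rcases hlt l hli with h | rfl
        · exact hmin.trans (hle l hl h)
        · exact le_rfl
      · simp only [Test.holds, hucb, RExp.eval, NExp.eval, not_le] at hmin
        refine ⟨fun l hl hli => ?_, l₀, hl₀, heq⟩
        rcases hlt l hli with h | rfl
        · exact hle l hl h
        · exact hmin.le
    · rw [htest] at hin
      refine ⟨fun l hl hli => ?_, l₀, hl₀, heq⟩
      rcases hlt l hli with h | rfl
      · exact hle l hl h
      · exact absurd hl hin

end

/-- The rule for filling a two-dimensional array. -/
theorem exec_fill {x y a v : ℕ} {e f : NExp} {A : Program} {m : Memory} {N M : ℕ}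
    (hN : e.eval m = N)
    (hM : ∀ m', (loop x e (loop y f (.seq A (.setReal a (cell x) (cell y) (realCell v))))).Agree
      m m' → f.eval m' = M)
    (hxy : x ≠ y) (hx : x ∉ A.natWrites) (hy : y ∉ A.natWrites) (ha : a ∉ A.realWrites)
    (F : ℕ → ℕ → ℝ)
    (hval : ∀ i j m', i < N → j < M →
      (loop x e (loop y f (.seq A (.setReal a (cell x) (cell y) (realCell v))))).Agree m m' →
      m'.nat x 0 0 = i → m'.nat y 0 0 = j → (A.exec m').real v 0 0 = F i j) :
    ∀ i < N, ∀ j < M,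
      ((loop x e (loop y f (.seq A (.setReal a (cell x) (cell y) (realCell v))))).exec m).real
        a i j = F i j := by
  refine grid_rule hN hM (by simp [natWrites, hxy, hx]) (fun i j m' => m'.real a i j = F i j)
    (fun _ _ _ _ h => h) (fun _ _ _ _ h => h) ?_
  intro i j m' hi hj hag hxi hyj hprev i' j' hj' hlt
  have hx' : (A.exec m').nat x 0 0 = i := by rw [exec_nat_of_notMem m' hx, hxi]
  have hy' : (A.exec m').nat y 0 0 = j := by rw [exec_nat_of_notMem m' hy, hyj]
  simp only [exec_seq, exec_setReal, NExp.eval, RExp.eval, hx', hy', Memory.setReal_real,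
    hval i j m' hi hj hag hxi hyj, true_and]
  split_ifs with h
  · rw [h.1, h.2]
  · rw [exec_real_of_notMem m' ha]
    exact hprev i' j' hj' (by omega)

theorem exec_maximalProg {T B : ℕ} {c : Fin K → ℕ} {σ : Equiv.Perm (Fin K)} {p : Fin U → Fin K}
    {h : List (Obs U K)} {m : Memory} (hm : Holds T B c σ p h m)
    (hpk : ∀ u : Fin U, m.nat 6 u 0 = (σ.symm (p u) : ℕ) + 1) (u : Fin U) (j : ℕ) (hj : j ≤ K) :
    (maximalProg.exec m).real 2 u j = pad (fun j => maximalMatrix T σ p h u (σ j)) j := by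
  have key := exec_fill (x := 10) (y := 11) (a := 2) (v := 6) (e := usersExp)
    (f := .add armsExp (.lit 1)) (A := .ite (.natLe (.lit 1) (cell 11)) minProg
      (setRealCell 6 (.ofNat (.lit 0)))) (m := m) (N := U) (M := K + 1) hm.users
    (fun m' hag => by
      have hm' := hm.of_agree hag (by decide) (by decide)
      simp [NExp.eval, hm'.arms]) (by decide) (by decide) (by decide) (by decide)
    (fun i j => if hi : i < U then pad (fun j => maximalMatrix T σ p h ⟨i, hi⟩ (σ j)) j else 0)
    (by
      intro i j m' hi hj hag hx hy
      have hm' := hm.of_agree hag (by decide) (by decide)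
      rw [dif_pos hi, exec_ite]
      simp only [Test.holds, NExp.eval, hy]
      cases j with
      | zero => simp [RExp.eval, NExp.eval]
      | succ j =>
        rw [if_pos (by omega), pad_succ' _ (show j < K by omega)]
        exact exec_minProg hm' (by rw [hag.nat 6 (by decide)]; exact hpk) ⟨i, hi⟩
          ⟨j, by omega⟩ hx hy)
  rw [maximalProg, key u u.2 j (by omega), dif_pos u.2]

/-- A sum over some of the users as an iterated sum. -/
theorem sum_filter_eq_sum_range (s : Fin U → Prop) [DecidablePred s] (f : Fin U → ℝ) :
    ∑ u with s u, f u = ∑ i ∈ Finset.range U, if h : i < U then (if s ⟨i, h⟩ then f ⟨i, h⟩ else 0)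
      else 0 := by
  rw [Finset.sum_filter, Finset.sum_range]
  refine Finset.sum_congr rfl fun u _ => ?_
  rw [dif_pos u.2]

section

variable {P : Fin U → Fin K → ℝ} {q : Fin U → Fin K} {c : Fin K → ℕ} {m : Memory}

theorem exec_gainProg (hU : m.nat 0 0 0 = U) (hq : ∀ u : Fin U, m.nat 6 u 0 = (q u : ℕ) + 1)
    (hP : ∀ (u : Fin U), ∀ j ≤ K, m.real 2 u j = pad (P u) j) {i j : ℕ} (hi : i ≤ K) (hj : j ≤ K)
    (h10 : m.nat 10 0 0 = i) (h11 : m.nat 11 0 0 = j) :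
    (gainProg.exec m).real 5 0 0 = spG P q i j := by
  rw [spG, sum_filter_eq_sum_range, gainProg, exec_seq]
  refine loop_rule (e := usersExp) (N := U) (by simpa [NExp.eval] using hU) (fun n m' => m'.real 5 0 0 = ∑ x ∈ Finset.range n,
    if hx : x < U then
      (if i < (q ⟨x, hx⟩ : ℕ) + 1 ∧ (q ⟨x, hx⟩ : ℕ) + 1 ≤ j then
        max (pad (P ⟨x, hx⟩) i) (pad (P ⟨x, hx⟩) j) else 0) else 0)
    ?_ (fun _ _ _ h => h) ?_
  · simp [NExp.eval, RExp.eval]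
  · intro n m' hn hag hx hI
    have h6 := hq ⟨n, hn⟩
    have h2i := hP ⟨n, hn⟩ i hi
    have h2j := hP ⟨n, hn⟩ j hj
    have e10 : m'.nat 10 0 0 = i := by rw [hag.nat 10 (by decide)]; exact h10
    have e11 : m'.nat 11 0 0 = j := by rw [hag.nat 11 (by decide)]; exact h11
    have e6 : m'.nat 6 n 0 = (q ⟨n, hn⟩ : ℕ) + 1 := by rw [hag.nat 6 (by decide)]; exact h6
    have e2i : m'.real 2 n i = pad (P ⟨n, hn⟩) i := by
      rw [hag.real 2 (by decide), exec_real_of_notMem m (by decide)]; exact h2i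
    have e2j : m'.real 2 n j = pad (P ⟨n, hn⟩) j := by
      rw [hag.real 2 (by decide), exec_real_of_notMem m (by decide)]; exact h2j
    rw [Finset.sum_range_succ, dif_pos hn, ← hI]
    simp only [exec_ite, exec_setReal, exec_skip, Test.holds, NExp.eval, RExp.eval, e10, e11, hx,
      e6, e2i, e2j]
    by_cases hc : i < (q ⟨n, hn⟩ : ℕ) + 1 ∧ (q ⟨n, hn⟩ : ℕ) + 1 ≤ j
    · rw [if_pos (by omega), if_pos hc]
      split_ifs with hle
      · simp [max_eq_right hle]
      · simp [max_eq_left (not_le.1 hle).le]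
    · rw [if_neg (by omega), if_neg hc, add_zero]

theorem exec_gainsProg (hU : m.nat 0 0 0 = U) (hK : m.nat 0 1 0 = K)
    (hq : ∀ u : Fin U, m.nat 6 u 0 = (q u : ℕ) + 1)
    (hP : ∀ (u : Fin U), ∀ j ≤ K, m.real 2 u j = pad (P u) j) {i j : ℕ} (hi : i ≤ K)
    (hj : j ≤ K) : (gainsProg.exec m).real 3 i j = spG P q i j := by
  refine exec_fill (A := gainProg) (N := K + 1) (M := K + 1) (by simp [NExp.eval, hK])
    (fun m' hag => by
      simp only [NExp.eval]
      rw [hag.nat 0 (by decide), hK])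
    (by decide) (by decide) (by decide) (by decide) (spG P q) ?_ i (by omega) j (by omega)
  intro i j m' hi hj hag hx hy
  exact exec_gainProg (by rw [hag.nat 0 (by decide)]; exact hU)
    (by rw [hag.nat 6 (by decide)]; exact hq) (by rw [hag.real 2 (by decide)]; exact hP)
    (by omega) (by omega) hx hy

end

end Machine

theorem argmax_insert {s : Finset ℕ} {i : ℕ} (hs : ∀ j ∈ s, j < i) (f : ℕ → ℝ) :
    argmax (insert i s) f = if s.Nonempty ∧ f i ≤ f (argmax s f) then argmax s f else i := by
  rw [argmax_eq_iff (Finset.insert_nonempty _ _)]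
  split_ifs with h
  · obtain ⟨hne, hle⟩ := h
    obtain ⟨h1, h2, h3⟩ := (argmax_eq_iff hne f _).1 rfl
    refine ⟨Finset.mem_insert_of_mem h1, fun j hj => ?_, fun j hj hlt => ?_⟩
    · rcases Finset.mem_insert.1 hj with rfl | hj
      · exact hle
      · exact h2 j hj
    · rcases Finset.mem_insert.1 hj with rfl | hj
      · exact absurd (hs _ h1) (by omega)
      · exact h3 j hj hlt
  · have hlt : ∀ j ∈ s, f j < f i := fun j hj => by
      by_contra! hle
      exact h ⟨⟨j, hj⟩, hle.trans (le_argmax f hj)⟩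
    refine ⟨Finset.mem_insert_self _ _, fun j hj => ?_, fun j hj hji => ?_⟩
    · rcases Finset.mem_insert.1 hj with rfl | hj
      · exact le_rfl
      · exact (hlt j hj).le
    · rcases Finset.mem_insert.1 hj with rfl | hj
      · omega
      · exact hlt j hj

theorem filter_lt_succ_of_mem {s : Finset ℕ} {n : ℕ} (hn : n ∈ s) :
    {j ∈ s | j < n + 1} = insert n {j ∈ s | j < n} := by
  ext j
  simp only [Finset.mem_filter, Finset.mem_insert]
  constructor
  · rintro ⟨hj, hlt⟩
    rcases Nat.lt_succ_iff_lt_or_eq.1 hlt with h | h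
    · exact Or.inr ⟨hj, h⟩
    · exact Or.inl h
  · rintro (rfl | ⟨hj, hlt⟩)
    · exact ⟨hn, by omega⟩
    · exact ⟨hj, by omega⟩

theorem filter_lt_succ_of_notMem {s : Finset ℕ} {n : ℕ} (hn : n ∉ s) :
    {j ∈ s | j < n + 1} = {j ∈ s | j < n} := by
  refine Finset.filter_congr fun j hj => ?_
  have : j ≠ n := fun h => hn (h ▸ hj)
  omega

theorem filter_lt_zero (s : Finset ℕ) : {j ∈ s | j < 0} = ∅ := by simp

namespace Machine

open Program

section

variable {P : Fin U → Fin K → ℝ} {q : Fin U → Fin K} {c : Fin K → ℕ} {m : Memory}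

theorem exec_entryProg (hK : m.nat 0 1 0 = K) (hc : ∀ j ≤ K, m.nat 7 j 0 = pad c j)
    (hG : ∀ i ≤ K, ∀ j ≤ K, m.real 3 i j = spG P q i j) {B k b : ℕ} (hk : 1 ≤ k) (hkK : k ≤ K)
    (hb : b ≤ B) (hF : ∀ l < k, ∀ b' ≤ B, m.real 4 l b' = spF P q c l b')
    (h10 : m.nat 10 0 0 = k) (h11 : m.nat 11 0 0 = b) :
    (entryProg.exec m).real 6 0 0 = spF P q c k b ∧
      (entryProg.exec m).nat 9 0 0 = spPrev P q c k b := by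
  set f : ℕ → ℝ := fun i => spF P q c i (b - pad c k) + spG P q i k with hf
  set S := spCandidates c k b with hS
  have hcand : ∀ (m' : Memory) (e : NExp) (l : ℕ), m'.nat 7 = m.nat 7 → m'.nat 10 = m.nat 10 →
      m'.nat 11 = m.nat 11 → m'.real 3 = m.real 3 → m'.real 4 = m.real 4 → e.eval m' = l → l < k →
      (candidateExp e).eval m' = f l := by
    intro m' e l e7 e10 e11 e3 e4 el hl
    simp only [candidateExp, RExp.eval, NExp.eval, e7, e10, e11, e3, e4, el, h10, h11,
      hc k hkK, hG l (by omega) k hkK, hF l hl _ (show b - pad c k ≤ B by omega), hf]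
  rw [entryProg, exec_seq, exec_seq]
  set m1 := (setCell 9 (.lit 0)).exec m with hm1
  set m2 := (setRealCell 6 (candidateExp (.lit 0))).exec m1 with hm2
  have h10' : m2.nat 10 = m.nat 10 := by
    rw [hm2, exec_nat_of_notMem _ (by decide), hm1, exec_nat_of_notMem _ (by decide)]
  have h11' : m2.nat 11 = m.nat 11 := by
    rw [hm2, exec_nat_of_notMem _ (by decide), hm1, exec_nat_of_notMem _ (by decide)]
  have h7' : m2.nat 7 = m.nat 7 := by
    rw [hm2, exec_nat_of_notMem _ (by decide), hm1, exec_nat_of_notMem _ (by decide)]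
  have h3' : m2.real 3 = m.real 3 := by
    rw [hm2, exec_real_of_notMem _ (by decide), hm1, exec_real_of_notMem _ (by decide)]
  have h4' : m2.real 4 = m.real 4 := by
    rw [hm2, exec_real_of_notMem _ (by decide), hm1, exec_real_of_notMem _ (by decide)]
  have hval : (candidateExp (.lit 0)).eval m1 = f 0 := by
    refine hcand m1 _ 0 ?_ ?_ ?_ ?_ ?_ rfl hk
    · rw [hm1, exec_nat_of_notMem _ (by decide)]
    · rw [hm1, exec_nat_of_notMem _ (by decide)]
    · rw [hm1, exec_nat_of_notMem _ (by decide)]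
    · rw [hm1, exec_real_of_notMem _ (by decide)]
    · rw [hm1, exec_real_of_notMem _ (by decide)]
  have hloop := loop_rule (x := 12) (e := armsExp) (body :=
      (.ite (.natLe (.add (.sub (.add (cell 12) (.lit 1)) (cell 10))
          (.sub (.add (entry 7 (cell 12)) (entry 7 (cell 10))) (cell 11))) (.lit 0))
        (.ite (.realLe (candidateExp (cell 12)) (realCell 6)) .skip
          (.seq (setCell 9 (cell 12)) (setRealCell 6 (candidateExp (cell 12)))))
        .skip)) (m := m2) (N := K)
    (by simp only [NExp.eval]; rw [hm2, exec_nat_of_notMem _ (by decide), hm1,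
          exec_nat_of_notMem _ (by decide), hK])
    (fun n m' => m'.nat 9 0 0 = argmax {j ∈ S | j < n} f ∧
      m'.real 6 0 0 = f (argmax {j ∈ S | j < n} f)) ?_ ?_ ?_
  · have hall : {j ∈ S | j < K} = S := Finset.filter_true_of_mem fun j hj =>
      lt_of_lt_of_le (mem_spCandidates.1 hj).1 hkK
    rw [hall] at hloop
    exact ⟨hloop.2.trans (spF_rec P q c hk hkK b).symm, hloop.1⟩
  · rw [filter_lt_zero, argmax_empty]
    refine ⟨?_, ?_⟩
    · rw [hm2, exec_nat_of_notMem _ (by decide), hm1]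
      simp [NExp.eval]
    · rw [hm2, exec_setReal, hval]
      simp [NExp.eval]
  · intro i m' v hI
    simpa using hI
  · intro n m' hn hag hx ⟨h9, h6⟩
    have e10 : m'.nat 10 0 0 = k := by rw [hag.nat 10 (by decide), h10', h10]
    have e11 : m'.nat 11 0 0 = b := by rw [hag.nat 11 (by decide), h11', h11]
    have e7 : ∀ j ≤ K, m'.nat 7 j 0 = pad c j := by rw [hag.nat 7 (by decide), h7']; exact hc
    have htest : (Test.natLe (.add (.sub (.add (cell 12) (.lit 1)) (cell 10))
          (.sub (.add (entry 7 (cell 12)) (entry 7 (cell 10))) (cell 11))) (.lit 0)).holds m' ↔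
        n ∈ S := by
      simp only [Test.holds, NExp.eval, e10, e11, hx, e7 n hn.le, e7 k hkK, hS, mem_spCandidates]
      omega
    rw [exec_ite]
    split_ifs with hin
    · rw [htest] at hin
      have hnk := (mem_spCandidates.1 hin).1
      have hc' : ∀ m'' : Memory, m''.nat 12 0 0 = n → m''.nat 7 = m'.nat 7 →
          m''.nat 10 = m'.nat 10 → m''.nat 11 = m'.nat 11 → m''.real = m'.real →
          (candidateExp (cell 12)).eval m'' = f n := fun m'' e12 a7 a10 a11 ar =>
        hcand m'' _ n (by rw [a7, hag.nat 7 (by decide), h7'])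
          (by rw [a10, hag.nat 10 (by decide), h10']) (by rw [a11, hag.nat 11 (by decide), h11'])
          (by rw [ar, hag.real 3 (by decide), h3']) (by rw [ar, hag.real 4 (by decide), h4'])
          (by simp [NExp.eval, e12]) hnk
      have hc1 := hc' m' hx rfl rfl rfl rfl
      have hc2 := hc' (m'.setNat 9 0 0 n) (by simpa using hx) (Memory.setNat_nat_ne _ (by decide) _ _ _)
        (Memory.setNat_nat_ne _ (by decide) _ _ _) (Memory.setNat_nat_ne _ (by decide) _ _ _) rfl
      rw [filter_lt_succ_of_mem hin, argmax_insert fun j hj => (Finset.mem_filter.1 hj).2]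
      rw [exec_ite]
      simp only [Test.holds, hc1, RExp.eval, NExp.eval, h6, exec_skip, exec_seq, exec_setNat, hx,
        exec_setReal, hc2]
      by_cases hle : f n ≤ f (argmax {j ∈ S | j < n} f)
      · rw [if_pos hle]
        rcases Finset.eq_empty_or_nonempty {j ∈ S | j < n} with hemp | hne
        · have h0 : n = 0 := by
            by_contra hn0
            have : 0 ∈ {j ∈ S | j < n} := by
              refine Finset.mem_filter.2 ⟨zero_mem_spCandidates c hk ?_, by omega⟩
              have := (mem_spCandidates.1 hin).2
              omega
            simp [hemp] at this
          simp [h9, h6, h0]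
        · simp [hne, hle, h9, h6]
      · rw [if_neg hle, if_neg fun h => hle h.2]
        simp
    · rw [htest] at hin
      rw [filter_lt_succ_of_notMem hin]
      exact ⟨h9, h6⟩

theorem exec_tableProg (hK : m.nat 0 1 0 = K) {B : ℕ} (hB : m.nat 0 2 0 = B)
    (hc : ∀ j ≤ K, m.nat 7 j 0 = pad c j)
    (hG : ∀ i ≤ K, ∀ j ≤ K, m.real 3 i j = spG P q i j) {k b : ℕ} (hk : k ≤ K) (hb : b ≤ B) :
    (tableProg.exec m).real 4 k b = spF P q c k b ∧
      (1 ≤ k → (tableProg.exec m).nat 8 k b = spPrev P q c k b) := by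
  refine grid_rule (x := 10) (y := 11) (e := .add armsExp (.lit 1)) (f := .add budgetExp (.lit 1))
    (N := K + 1) (M := B + 1) (by simp [NExp.eval, hK])
    (fun m' hag => by
      simp only [NExp.eval]
      rw [hag.nat 0 (by decide), hB]) (by decide)
    (fun k b m' => m'.real 4 k b = spF P q c k b ∧
      (1 ≤ k → m'.nat 8 k b = spPrev P q c k b)) ?_ ?_ ?_ k (by omega) b (by omega)
  · intro i j m' v h
    simpa using h
  · intro i j m' v h
    simpa using h
  · intro k b m' hk hb hag hx hy hprev k' b' hb' hlt
    set A : Program := .ite (.natLe (.lit 1) (cell 10)) entryProg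
      (setRealCell 6 (.ofNat (.lit 0))) with hA
    have hval : (A.exec m').real 6 0 0 = spF P q c k b ∧
        (1 ≤ k → (A.exec m').nat 9 0 0 = spPrev P q c k b) := by
      rw [hA, exec_ite]
      simp only [Test.holds, NExp.eval, hx]
      split_ifs with hk1
      · have := exec_entryProg (m := m') (P := P) (q := q) (c := c) (B := B)
          (by rw [hag.nat 0 (by decide)]; exact hK) (by rw [hag.nat 7 (by decide)]; exact hc)
          (by rw [hag.real 3 (by decide)]; exact hG) hk1 (by omega) (show b ≤ B by omega)
          (fun l hl b' hb' => (hprev l b' (by omega) (Or.inl hl)).1) hx hy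
        exact ⟨this.1, fun _ => this.2⟩
      · obtain rfl : k = 0 := by omega
        simp [RExp.eval, NExp.eval, spF_zero]
    have e10 : (A.exec m').nat 10 0 0 = k := by rw [exec_nat_of_notMem _ (by decide), hx]
    have e11 : (A.exec m').nat 11 0 0 = b := by rw [exec_nat_of_notMem _ (by decide), hy]
    simp only [exec_seq, exec_setReal, exec_setNat, NExp.eval, RExp.eval, e10, e11,
      Memory.setReal_real, Memory.setNat_nat, Memory.setNat_real, Memory.setReal_nat, true_and]
    by_cases h : k' = k ∧ b' = b
    · obtain ⟨rfl, rfl⟩ := h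
      simpa using hval
    · rw [if_neg h, if_neg h, exec_nat_of_notMem _ (by decide), exec_real_of_notMem _ (by decide)]
      exact hprev k' b' hb' (by omega)

theorem exec_restProg (hU : m.nat 0 0 0 = U) (hq : ∀ u : Fin U, m.nat 6 u 0 = (q u : ℕ) + 1)
    (hP : ∀ (u : Fin U), ∀ j ≤ K, m.real 2 u j = pad (P u) j) {k : ℕ} (hk : k < K)
    (h10 : m.nat 10 0 0 = k) :
    (restProg.exec m).real 5 0 0 = ∑ u with k + 1 < (q u : ℕ) + 1, pad (P u) (k + 1) := by
  rw [sum_filter_eq_sum_range, restProg, exec_seq]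
  refine loop_rule (e := usersExp) (N := U) (by simpa [NExp.eval] using hU)
    (fun n m' => m'.real 5 0 0 = ∑ x ∈ Finset.range n, if hx : x < U then
      (if k + 1 < (q ⟨x, hx⟩ : ℕ) + 1 then pad (P ⟨x, hx⟩) (k + 1) else 0) else 0)
    ?_ (fun _ _ _ h => h) ?_
  · simp [NExp.eval, RExp.eval]
  · intro n m' hn hag hx hI
    have h6 := hq ⟨n, hn⟩
    have h2 := hP ⟨n, hn⟩ (k + 1) hk
    have e10 : m'.nat 10 0 0 = k := by rw [hag.nat 10 (by decide)]; exact h10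
    have e6 : m'.nat 6 n 0 = (q ⟨n, hn⟩ : ℕ) + 1 := by rw [hag.nat 6 (by decide)]; exact h6
    have e2 : m'.real 2 n (k + 1) = pad (P ⟨n, hn⟩) (k + 1) := by
      rw [hag.real 2 (by decide), exec_real_of_notMem m (by decide)]; exact h2
    rw [Finset.sum_range_succ, dif_pos hn, ← hI]
    simp only [exec_ite, exec_setReal, exec_skip, Test.holds, NExp.eval, RExp.eval, e10, hx, e6, e2]
    by_cases hlt : k + 1 < (q ⟨n, hn⟩ : ℕ) + 1
    · rw [if_pos (by omega), if_pos hlt]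
      simp
    · rw [if_neg (by omega), if_neg hlt, add_zero]

theorem exec_lastProg (hU : m.nat 0 0 0 = U) (hK : m.nat 0 1 0 = K) {B : ℕ}
    (hB : m.nat 0 2 0 = B) (hq : ∀ u : Fin U, m.nat 6 u 0 = (q u : ℕ) + 1)
    (hP : ∀ (u : Fin U), ∀ j ≤ K, m.real 2 u j = pad (P u) j)
    (hF : ∀ k ≤ K, m.real 4 k B = spF P q c k B) :
    (lastProg.exec m).nat 14 0 0 = spLast P q c B := by
  set f : ℕ → ℝ := fun k => spF P q c k B + ∑ u with k < (q u : ℕ) + 1, pad (P u) k with hf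
  have hIcc : ∀ n, Finset.Icc 1 (n + 1) = insert (n + 1) (Finset.Icc 1 n) := fun n => by
    ext j
    simp only [Finset.mem_Icc, Finset.mem_insert]
    omega
  rw [lastProg, exec_seq]
  refine (loop_rule (e := armsExp) (N := K) (by simpa [NExp.eval] using hK)
    (fun n m' => m'.nat 14 0 0 = argmax (Finset.Icc 1 n) f ∧
      (1 ≤ n → m'.real 6 0 0 = f (argmax (Finset.Icc 1 n) f))) ?_ ?_ ?_).1
  · simp [NExp.eval]
  · intro i m' v h
    simpa using h
  · intro n m' hn hag hx ⟨h14, h6⟩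
    set m1 := restProg.exec m' with hm1
    have hrest : m1.real 5 0 0 = ∑ u with n + 1 < (q u : ℕ) + 1, pad (P u) (n + 1) :=
      exec_restProg (by rw [hag.nat 0 (by decide)]; exact hU)
        (by rw [hag.nat 6 (by decide)]; exact hq) (by rw [hag.real 2 (by decide)]; exact hP) hn hx
    have e0 : m1.nat 0 2 0 = B := by
      rw [hm1, exec_nat_of_notMem _ (by decide), hag.nat 0 (by decide)]; exact hB
    have e10 : m1.nat 10 0 0 = n := by rw [hm1, exec_nat_of_notMem _ (by decide), hx]
    have e14 : m1.nat 14 0 0 = argmax (Finset.Icc 1 n) f := by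
      rw [hm1, exec_nat_of_notMem _ (by decide), h14]
    have e4 : m1.real 4 (n + 1) B = spF P q c (n + 1) B := by
      rw [hm1, exec_real_of_notMem _ (by decide), hag.real 4 (by decide)]; exact hF _ hn
    have e6 : m1.real 6 0 0 = m'.real 6 0 0 := by rw [hm1, exec_real_of_notMem _ (by decide)]
    have hfn : m1.real 4 (n + 1) B + m1.real 5 0 0 = f (n + 1) := by rw [e4, hrest]
    rw [hIcc, argmax_insert fun j hj => by have := Finset.mem_Icc.1 hj; omega]
    simp only [exec_seq, ← hm1, exec_setReal, exec_setNat, exec_ite, exec_skip, lastUpdate,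
      Test.holds, NExp.eval, RExp.eval, Memory.setReal_real, Memory.setReal_nat,
      Memory.setNat_real, e0, e10, e14, e6, hfn, and_self, if_true]
    rcases Nat.eq_zero_or_pos n with rfl | hn0
    · simp
    · have hne : (Finset.Icc 1 n).Nonempty := ⟨1, Finset.mem_Icc.2 ⟨le_rfl, hn0⟩⟩
      have h1 := (Finset.mem_Icc.1 (argmax_mem hne f)).1
      have h6' := h6 hn0
      by_cases hle : f (n + 1) ≤ f (argmax (Finset.Icc 1 n) f)
      · simp [h1, h6', hle, hne, e14, e6]
      · simp [h1, h6', hle]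

theorem exec_clearProg (hK : m.nat 0 1 0 = K) {B : ℕ} (hB : m.nat 0 2 0 = B) :
    (∀ j ≤ K, (clearProg.exec m).nat 13 j 0 = 0) ∧ (clearProg.exec m).nat 15 0 0 = B := by
  rw [clearProg, exec_seq]
  constructor
  · intro j hj
    rw [exec_nat_of_notMem _ (by decide)]
    refine loop_rule (e := .add armsExp (.lit 1)) (N := K + 1) (by simp [NExp.eval, hK])
      (fun n m' => ∀ j < n, m'.nat 13 j 0 = 0) (by simp) ?_ ?_ j (by omega)
    · intro i m' v h
      simpa using h
    · intro n m' hn hag hx hI j hj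
      simp only [exec_setNat, NExp.eval, hx, Memory.setNat_nat, true_and, and_true]
      split_ifs with h
      · rfl
      · exact hI j (by omega)
  · rw [exec_setNat]
    simp only [NExp.eval, Memory.setNat_nat, and_self, if_true]
    rw [exec_nat_of_notMem _ (by decide), hB]

theorem exec_backtrackProg (hK : m.nat 0 1 0 = K) (hc : ∀ j ≤ K, m.nat 7 j 0 = pad c j) {B : ℕ}
    (hprev : ∀ k ≤ K, 1 ≤ k → ∀ b ≤ B, m.nat 8 k b = spPrev P q c k b)
    (hclear : ∀ j ≤ K, m.nat 13 j 0 = 0) (h15 : m.nat 15 0 0 = B) {k₀ : ℕ} (hk₀ : k₀ ≤ K)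
    (h14 : m.nat 14 0 0 = k₀) {j : ℕ} (hj : j ≤ K) :
    1 ≤ (backtrackProg.exec m).nat 13 j 0 ↔ j ∈ spBacktrack P q c K k₀ B := by
  have hloop := loop_rule (x := 10) (e := armsExp) (body := .ite (.natLe (.lit 1) (cell 14))
      (.seq (.setNat 13 (cell 14) (.lit 0) (.lit 1))
        (.seq (setCell 9 (.get 8 (cell 14) (cell 15)))
          (.seq (setCell 15 (.sub (cell 15) (entry 7 (cell 14))))
            (setCell 14 (cell 9)))))
      .skip) (N := K) (m := m) hK
    (fun n m' => m'.nat 14 0 0 ≤ K ∧ m'.nat 15 0 0 ≤ B ∧ ∀ j ≤ K, (1 ≤ m'.nat 13 j 0 ∨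
      j ∈ spBacktrack P q c (K - n) (m'.nat 14 0 0) (m'.nat 15 0 0)) ↔
      j ∈ spBacktrack P q c K k₀ B) ?_ ?_ ?_
  · have := hloop.2.2 j hj
    rw [Nat.sub_self, spBacktrack] at this
    simpa [backtrackProg] using this
  · refine ⟨by omega, by omega, fun j hj => ?_⟩
    rw [hclear j hj, h14, h15]
    simp
  · intro i m' v h
    simpa using h
  · intro n m' hn hag hx ⟨h1, h2, h3⟩
    obtain ⟨l, hl⟩ : ∃ l, K - n = l + 1 := ⟨K - n - 1, by omega⟩
    have hl' : K - (n + 1) = l := by omega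
    rw [hl']
    rw [hl] at h3
    set k := m'.nat 14 0 0 with hkdef
    set b := m'.nat 15 0 0 with hbdef
    have e7 : m'.nat 7 k 0 = pad c k := by rw [hag.nat 7 (by decide)]; exact hc k h1
    rw [exec_ite]
    simp only [Test.holds, NExp.eval, ← hkdef]
    split_ifs with hk1
    · have e8 : m'.nat 8 k b = spPrev P q c k b := by
        rw [hag.nat 8 (by decide)]; exact hprev k h1 hk1 b h2
      have hlt := spPrev_lt P q c b hk1
      have hbt : spBacktrack P q c (l + 1) k b =
          insert k (spBacktrack P q c l (spPrev P q c k b) (b - pad c k)) := by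
        rw [spBacktrack, if_neg (by omega)]
      simp only [exec_seq, exec_setNat, NExp.eval, Memory.setNat_nat]
      norm_num [← hkdef, ← hbdef, e7, e8]
      refine ⟨by omega, by omega, fun j hj => ?_⟩
      rw [← h3 j hj, hbt, Finset.mem_insert]
      by_cases hjk : j = k
      · simp [hjk]
      · simp [hjk]
    · have hk0 : k = 0 := by omega
      refine ⟨h1, h2, fun j hj => ?_⟩
      rw [exec_skip, ← hkdef, ← hbdef, ← h3 j hj, hk0]
      cases l <;> simp [spBacktrack]

theorem exec_bestProg (hK : m.nat 0 1 0 = K) {u : Fin U}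
    (hP : ∀ j ≤ K, m.real 2 u j = pad (P u) j) {S : Finset ℕ} (hS : ∀ j ∈ S, 1 ≤ j ∧ j ≤ K)
    (hsel : ∀ j ≤ K, 1 ≤ m.nat 13 j 0 ↔ j ∈ S) (h10 : m.nat 10 0 0 = u) :
    (bestProg.exec m).nat 9 0 0 = argmax S (pad (P u)) := by
  have hall : {j ∈ S | j < K + 1} = S := Finset.filter_true_of_mem fun j hj => by
    have := hS j hj
    omega
  rw [← hall, bestProg, exec_seq]
  refine loop_rule (e := .add armsExp (.lit 1)) (N := K + 1) (by simpa [NExp.eval] using hK)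
    (fun n m' => m'.nat 9 0 0 = argmax {j ∈ S | j < n} (pad (P u))) ?_ ?_ ?_
  · simp [NExp.eval]
  · intro i m' v h
    simpa using h
  · intro n m' hn hag hx h9
    have e10 : m'.nat 10 0 0 = u := by
      rw [hag.nat 10 (by decide), exec_nat_of_notMem _ (by decide), h10]
    have e13 : 1 ≤ m'.nat 13 n 0 ↔ n ∈ S := by
      rw [hag.nat 13 (by decide), exec_nat_of_notMem _ (by decide)]
      exact hsel n (by omega)
    have e2 : ∀ j ≤ K, m'.real 2 u j = pad (P u) j := by
      rw [hag.real 2 (by decide), exec_real_of_notMem _ (by decide)]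
      exact hP
    simp only [exec_ite, exec_setNat, exec_skip, Test.holds, NExp.eval, RExp.eval, hx, e10, h9, e13]
    by_cases hnS : n ∈ S
    · rw [if_pos hnS, filter_lt_succ_of_mem hnS,
        argmax_insert fun j hj => (Finset.mem_filter.1 hj).2]
      rcases Finset.eq_empty_or_nonempty {j ∈ S | j < n} with hemp | hne
      · simp [hemp]
      · have h1 := hS _ (Finset.mem_filter.1 (argmax_mem hne (pad (P u)))).1
        rw [if_pos h1.1, e2 n (by omega), e2 _ h1.2]
        by_cases hle : pad (P u) n ≤ pad (P u) (argmax {j ∈ S | j < n} (pad (P u)))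
        · rw [if_pos hle, if_pos ⟨hne, hle⟩, h9]
        · rw [if_neg hle, if_neg fun h => hle h.2]
          simp
    · rw [if_neg hnS, filter_lt_succ_of_notMem hnS, h9]

end

theorem exec_outputProg {T B : ℕ} {c : Fin K → ℕ} {σ : Equiv.Perm (Fin K)} {p : Fin U → Fin K}
    {h : List (Obs U K)} {m : Memory} (hm : Holds T B c σ p h m) (hK : 0 < K)
    {P : Fin U → Fin K → ℝ} {q : Fin U → Fin K} {c' : Fin K → ℕ}
    (hP : ∀ (u : Fin U), ∀ j ≤ K, m.real 2 u j = pad (P u) j)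
    (hsel : ∀ j ≤ K, 1 ≤ m.nat 13 j 0 ↔ j ∈ spSelected P q c' B) (u : Fin U) :
    (outputProg.exec m).nat 4 u 0 = σ (spMatching P q c' B u) := by
  refine loop_rule (e := usersExp) (N := U) hm.users
    (fun n m' => ∀ u : Fin U, (u : ℕ) < n → m'.nat 4 u 0 = σ (spMatching P q c' B u))
    (fun u hu => by omega) ?_ ?_ u u.2
  · intro i m' v h
    simpa using h
  · intro n m' hn hag hx hI v hv
    have hm' := (hm.of_agree hag (by decide) (by decide)).exec (P := bestProg)
      (by decide) (by decide)
    have h9 := exec_bestProg (m := m') (u := ⟨n, hn⟩) (P := P) (S := spSelected P q c' B)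
      (by rw [hag.nat 0 (by decide)]; exact hm.arms)
      (by rw [hag.real 2 (by decide)]; exact hP ⟨n, hn⟩)
      (fun j hj => spSelected_bounds hK hj) (by rw [hag.nat 13 (by decide)]; exact hsel) hx
    rw [← spMatching_add_one P q c' B hK] at h9
    have e10 : (bestProg.exec m').nat 10 0 0 = n := by
      rw [exec_nat_of_notMem _ (by decide), hx]
    simp only [exec_seq, exec_setNat, NExp.eval, e10, h9, Nat.add_sub_cancel, hm'.order,
      Memory.setNat_nat, true_and, and_true]
    split_ifs with hvn
    · obtain rfl : v = ⟨n, hn⟩ := Fin.ext hvn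
      rfl
    · rw [exec_nat_of_notMem _ (by decide)]
      exact hI v (by omega)

section

variable {T B : ℕ} {c : Fin K → ℕ} {σ : Equiv.Perm (Fin K)} {p : Fin U → Fin K}
  {h : List (Obs U K)} {m : Memory}

theorem Holds.choose (hm : Holds T B c σ p h m) : Holds T B c σ p h (choose.exec m) :=
  hm.exec (by decide) (by decide)

/-- The first program outputs the matching of Match-via-Maximal. -/
theorem outputs_choose (hm : Holds T B c σ p h m) (hK : 0 < K) :
    (choose.exec m).Outputs (mvm T B c σ p h) := by
  set P : Fin U → Fin K → ℝ := fun v j => maximalMatrix T σ p h v (σ j) with hP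
  set q : Fin U → Fin K := fun v => σ.symm (p v) with hq
  set c' : Fin K → ℕ := fun j => c (σ j) with hc'
  simp only [Machine.choose, exec_seq]
  have h1 := hm.exec (P := costsProg) (by decide) (by decide)
  have a1 := exec_costsProg hm
  set m1 := costsProg.exec m
  have h2 := h1.exec (P := numbersProg) (by decide) (by decide)
  have a2 := exec_numbersProg h1
  have n27 : (numbersProg.exec m1).nat 7 = m1.nat 7 := exec_nat_of_notMem _ (by decide)
  set m2 := numbersProg.exec m1
  have h3 := h2.exec (P := peaksProg) (by decide) (by decide)
  have a3 := exec_peaksProg h2 a2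
  have n37 : (peaksProg.exec m2).nat 7 = m2.nat 7 := exec_nat_of_notMem _ (by decide)
  set m3 := peaksProg.exec m2
  have h4 := h3.exec (P := maximalProg) (by decide) (by decide)
  have a4 := exec_maximalProg h3 a3
  have n47 : (maximalProg.exec m3).nat 7 = m3.nat 7 := exec_nat_of_notMem _ (by decide)
  have n46 : (maximalProg.exec m3).nat 6 = m3.nat 6 := exec_nat_of_notMem _ (by decide)
  set m4 := maximalProg.exec m3
  have a46 : ∀ u : Fin U, m4.nat 6 u 0 = (q u : ℕ) + 1 := by rw [n46]; exact a3
  have h5 := h4.exec (P := gainsProg) (by decide) (by decide)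
  have a5 : ∀ i ≤ K, ∀ j ≤ K, (gainsProg.exec m4).real 3 i j = spG P q i j :=
    fun i hi j hj => exec_gainsProg h4.users h4.arms a46 a4 hi hj
  have n57 : (gainsProg.exec m4).nat 7 = m4.nat 7 := exec_nat_of_notMem _ (by decide)
  have n56 : (gainsProg.exec m4).nat 6 = m4.nat 6 := exec_nat_of_notMem _ (by decide)
  have r52 : (gainsProg.exec m4).real 2 = m4.real 2 := exec_real_of_notMem _ (by decide)
  set m5 := gainsProg.exec m4
  have a57 : ∀ j ≤ K, m5.nat 7 j 0 = pad c' j := by rw [n57, n47, n37, n27]; exact a1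
  have h6 := h5.exec (P := tableProg) (by decide) (by decide)
  have a6 : ∀ k ≤ K, ∀ b ≤ B, (tableProg.exec m5).real 4 k b = spF P q c' k b ∧
      (1 ≤ k → (tableProg.exec m5).nat 8 k b = spPrev P q c' k b) :=
    fun k hk b hb => exec_tableProg h5.arms h5.budget a57 a5 hk hb
  have n67 : (tableProg.exec m5).nat 7 = m5.nat 7 := exec_nat_of_notMem _ (by decide)
  have n66 : (tableProg.exec m5).nat 6 = m5.nat 6 := exec_nat_of_notMem _ (by decide)
  have r62 : (tableProg.exec m5).real 2 = m5.real 2 := exec_real_of_notMem _ (by decide)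
  set m6 := tableProg.exec m5
  have a62 : ∀ (u : Fin U), ∀ j ≤ K, m6.real 2 u j = pad (P u) j := by rw [r62, r52]; exact a4
  have h7 := h6.exec (P := lastProg) (by decide) (by decide)
  have a7 : (lastProg.exec m6).nat 14 0 0 = spLast P q c' B :=
    exec_lastProg h6.users h6.arms h6.budget (by rw [n66, n56]; exact a46) a62
      fun k hk => (a6 k hk B le_rfl).1
  have n77 : (lastProg.exec m6).nat 7 = m6.nat 7 := exec_nat_of_notMem _ (by decide)
  have n78 : (lastProg.exec m6).nat 8 = m6.nat 8 := exec_nat_of_notMem _ (by decide)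
  have r72 : (lastProg.exec m6).real 2 = m6.real 2 := exec_real_of_notMem _ (by decide)
  set m7 := lastProg.exec m6
  have h8 := h7.exec (P := clearProg) (by decide) (by decide)
  have a8 := exec_clearProg h7.arms h7.budget
  have n87 : (clearProg.exec m7).nat 7 = m7.nat 7 := exec_nat_of_notMem _ (by decide)
  have n88 : (clearProg.exec m7).nat 8 = m7.nat 8 := exec_nat_of_notMem _ (by decide)
  have n814 : (clearProg.exec m7).nat 14 = m7.nat 14 := exec_nat_of_notMem _ (by decide)
  have r82 : (clearProg.exec m7).real 2 = m7.real 2 := exec_real_of_notMem _ (by decide)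
  set m8 := clearProg.exec m7
  have h9 := h8.exec (P := backtrackProg) (by decide) (by decide)
  have a9 : ∀ j ≤ K, 1 ≤ (backtrackProg.exec m8).nat 13 j 0 ↔ j ∈ spSelected P q c' B :=
    fun j hj => exec_backtrackProg h8.arms (by rw [n87, n77, n67]; exact a57)
      (fun k hk hk1 b hb => by rw [n88, n78]; exact (a6 k hk b hb).2 hk1) a8.1 a8.2
      (Finset.mem_Icc.1 (spLast_mem P q c' B hK)).2 (by rw [n814]; exact a7) hj
  have r92 : (backtrackProg.exec m8).real 2 = m8.real 2 := exec_real_of_notMem _ (by decide)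
  exact fun u => exec_outputProg h9 hK (by rw [r92, r82, r72]; exact a62) a9 u

theorem Holds.receive (hm : Holds T B c σ p h m) (x : Fin U → ℝ) :
    Holds T B c σ p h (m.receive x) :=
  { hm with sums := fun u k => by simpa [Memory.receive] using hm.sums u k }

/-- The second program updates the statistics. -/
theorem Holds.learn (hm : Holds T B c σ p h m) {π : Matching U K} {x : Fin U → ℝ}
    (hπ : m.Outputs π) (hx : ∀ u : Fin U, m.real 0 u 0 = x u) :
    Holds T B c σ p (h ++ [(π, x)]) (Machine.learn.exec m) := by
  have hstat : ∀ u : Fin U, (u : ℕ) < U → ∀ k : Fin K,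
      (Machine.learn.exec m).nat 5 u k = CBR.pulls (h ++ [(π, x)]) u k ∧
      (Machine.learn.exec m).real 1 u k = obsSum (h ++ [(π, x)]) u k := by
    refine (loop_rule (e := usersExp) (N := U) hm.users
      (fun n m' => (∀ u : Fin U, (u : ℕ) < n → ∀ k : Fin K,
        m'.nat 5 u k = CBR.pulls (h ++ [(π, x)]) u k ∧
        m'.real 1 u k = obsSum (h ++ [(π, x)]) u k) ∧
        ∀ u : Fin U, n ≤ (u : ℕ) → ∀ k : Fin K,
        m'.nat 5 u k = CBR.pulls h u k ∧ m'.real 1 u k = obsSum h u k) ?_ ?_ ?_).1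
    · exact ⟨fun u hu => by omega, fun u _ k => ⟨hm.pulls u k, hm.sums u k⟩⟩
    · intro i m' v hI
      simpa using hI
    · intro n m' hn hag hctr ⟨hI1, hI2⟩
      have e4 : m'.nat 4 n 0 = π ⟨n, hn⟩ := by rw [hag.nat 4 (by decide)]; exact hπ ⟨n, hn⟩
      have e0 : m'.real 0 n 0 = x ⟨n, hn⟩ := by rw [hag.real 0 (by decide)]; exact hx ⟨n, hn⟩
      have hold := fun k => hI2 ⟨n, hn⟩ le_rfl k
      simp only at hold
      simp only [exec_seq, exec_setReal, exec_setNat, NExp.eval, RExp.eval, hctr, e4, e0,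
        Memory.setReal_nat, Memory.setNat_nat, Memory.setNat_real, Memory.setReal_real, hold,
        true_and]
      refine ⟨fun u hu k => ?_, fun u hu k => ?_⟩
      · rcases Nat.lt_succ_iff_lt_or_eq.1 hu with hlt | heq
        · have hne : (u : ℕ) ≠ n := hlt.ne
          simpa [hne] using hI1 u hlt k
        · obtain rfl : u = ⟨n, hn⟩ := Fin.ext heq
          rw [pulls_append_singleton, obsSum_append_singleton]
          by_cases hk : π ⟨n, hn⟩ = k
          · subst hk
            simp
          · have hk' : (k : ℕ) ≠ π ⟨n, hn⟩ := fun h => hk (Fin.ext h.symm)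
            simp [hk, hk', hold]
      · have hne : (u : ℕ) ≠ n := by omega
        simpa [hne] using hI2 u (by omega) k
  have hag : Machine.learn.Agree m (Machine.learn.exec m) := agree_exec _ _
  constructor
  · rw [hag.nat 0 (by decide)]; exact hm.users
  · rw [hag.nat 0 (by decide)]; exact hm.arms
  · rw [hag.nat 0 (by decide)]; exact hm.budget
  · rw [hag.nat 0 (by decide)]; exact hm.horizon
  · rw [hag.nat 1 (by decide)]; exact hm.costs
  · rw [hag.nat 2 (by decide)]; exact hm.order
  · rw [hag.nat 3 (by decide)]; exact hm.peaks
  · exact fun u k => (hstat u u.2 k).1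
  · exact fun u k => (hstat u u.2 k).2

theorem holds_initialMemory (T B : ℕ) (c : Fin K → ℕ) (σ : Equiv.Perm (Fin K))
    (p : Fin U → Fin K) : Holds T B c σ p [] (initialMemory T B c σ p) := by
  constructor <;> simp [initialMemory]

theorem memoryAt_succ (A L : Program) (m₀ : Memory) (x : ℕ → Fin U → ℝ) (t : ℕ) :
    memoryAt A L m₀ x (t + 1) = L.exec ((A.exec (memoryAt A L m₀ x t)).receive (x t)) := rfl

theorem roundSteps_eq (A L : Program) (m₀ : Memory) (x : ℕ → Fin U → ℝ) (t : ℕ) :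
    roundSteps A L m₀ x t = (A.run (memoryAt A L m₀ x t)).2 +
      (L.run ((A.exec (memoryAt A L m₀ x t)).receive (x t))).2 := rfl

theorem receive_nat (m : Memory) (x : Fin U → ℝ) : (m.receive x).nat = m.nat := rfl

theorem receive_real_zero (m : Memory) (x : Fin U → ℝ) (u : Fin U) :
    (m.receive x).real 0 u 0 = x u := by
  simp [Memory.receive]

/-- At the beginning of round `t` the machine holds the statistics of the first `t` rounds. -/
theorem holds_memoryAt (T B : ℕ) (c : Fin K → ℕ) (σ : Equiv.Perm (Fin K)) (p : Fin U → Fin K)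
    (hK : 0 < K) (r : Rewards U K) (t : ℕ) :
    Holds T B c σ p (history (mvm T B c σ p) r t)
      (memoryAt Machine.choose Machine.learn (initialMemory T B c σ p)
        (fun s u => r (s, u, play (mvm T B c σ p) r s u)) t) := by
  induction t with
  | zero => exact holds_initialMemory T B c σ p
  | succ t ih =>
    rw [history_succ, memoryAt_succ]
    have hout := outputs_choose ih hK
    have hch := ih.choose
    generalize Machine.choose.exec _ = m at hout hch ⊢
    exact (hch.receive _).learn hout fun u => receive_real_zero m _ u

theorem roundSteps_le (hU : 0 < U) (T B : ℕ) (c : Fin K → ℕ) (σ : Equiv.Perm (Fin K))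
    (p : Fin U → Fin K) (hK : 0 < K) (r : Rewards U K) (t : ℕ) :
    roundSteps Machine.choose Machine.learn (initialMemory T B c σ p)
      (fun s u => r (s, u, play (mvm T B c σ p) r s u)) t ≤ 10000 * (K ^ 2 * U + K ^ 2 * B) := by
  have hm := holds_memoryAt T B c σ p hK r t
  rw [roundSteps_eq]
  generalize memoryAt Machine.choose _ _ _ t = m at hm ⊢
  refine le_trans (add_le_add (steps_le_stepBound (m := m) (by decide) (by decide) rfl)
    (steps_le_stepBound (m := m) (by decide) (by decide) ?_))
    (stepBound_choose_add_learn_le hU hK hm.users hm.arms hm.budget)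
  rw [receive_nat, exec_nat_of_notMem m (by decide)]

end

end Machine

end CBR

theorem mainTheorem3 :
    ∃ (C : ℝ) (choose learn : CBR.Program),
      ∀ (U K : ℕ), 0 < U → 0 < K →
      ∀ (I : CBR.Instance U K) (σ : Equiv.Perm (Fin K)) (p : Fin U → Fin K),
        CBR.SPWithPeaks σ p I.Θ →
        -- regret of MvM
        I.regret (CBR.mvm I.T I.B I.c σ p) ≤ C * (U * √(I.T * K * Real.log I.T)) ∧
        -- on every table of rewards and in every round, MvM respects the budget, and the machine
        -- outputs the matching of MvM and takes `O(K²U + K²B)` steps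
        ∀ (r : CBR.Rewards U K) (t : ℕ), t < I.T →
          let π : ℕ → CBR.Matching U K := CBR.play (CBR.mvm I.T I.B I.c σ p) r
          let m₀ : CBR.Memory := CBR.initialMemory I.T I.B I.c σ p
          let x : ℕ → Fin U → ℝ := fun s u => r (s, u, π s u)
          CBR.Feasible I.c I.B (π t) ∧
          (choose.run (CBR.memoryAt choose learn m₀ x t)).1.Outputs (π t) ∧
          (CBR.roundSteps choose learn m₀ x t : ℝ) ≤
            C * ((K : ℝ) ^ 2 * U + (K : ℝ) ^ 2 * I.B) := by
  refine ⟨10000, CBR.Machine.choose, CBR.Machine.learn, fun U K hU hK I σ p hΘ => ⟨?_, ?_⟩⟩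
  · refine (CBR.regret_mvm_le I hU hK hΘ).trans ?_
    gcongr
    norm_num
  · intro r t _
    refine ⟨CBR.feasible_mvm _ _ _ _ _ hK I.cost_le _,
      CBR.Machine.outputs_choose (CBR.Machine.holds_memoryAt _ _ _ _ _ hK r t) hK, ?_⟩
    exact_mod_cast CBR.Machine.roundSteps_le hU I.T I.B I.c σ p hK r t
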